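/- Let $\psi^1,\psi^2\in C^\infty([0,1])$ (complex-valued) satisfy $\operatorname{supp}\psi^1\subset[0,\tfrac23]$, $\operatorname{supp}\psi^2\subset[\tfrac13,1]$ and $\psi^1+\psi^2\equiv1$ on $[0,1]$, and extend both functions to $\mathbb R$ by zero. Let $i\in\{0,1,2,\dots\}$, $r\in\{1,2,\dots\}$ and $s\in(-\tfrac12,i]$ with $r>\max\{s,i-1\}$. For a finite or countable collection $h=\{h_m\}$ of measurable functions on $\mathbb R$ and a nonnegative integer $k$, define the $[0,\infty]$-valued maximal function $$M_{k,2,s}h(x)=\sup_{Q\ni x}\ \inf_{P}\ \frac1{|Q|^{s}}\bigg(\frac1{|Q|}\int_Q\sum_m|h_m-P_m|^2\bigg)^{1/2},$$ where $Q$ runs over the bounded intervals of positive length containing $x$ and $P=\{P_m\}$ over all collections of polynomials of degree strictly less than $k$ (for $k=0$ only $P_m=0$); a scalar function is regarded as a one-element collection. Write $\widehat f(\xi)=\int_{\mathbb R} e^{-2\pi i x\xi}f(x)\,dx$, extended to a unitary operator on $L^2(\mathbb R)$ with inverse $g\mapsto g^\vee$. Then there is a finite constant $C$, depending only on $\psi^1,\psi^2,i,r,s$,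 such that the following holds. Let $\Delta_m=[a_m,b_m]$, $a_m<b_m$, be a finite or countable collection of pairwise disjoint intervals of lengths $l_m=b_m-a_m$ with $0\notin(a_m,b_m)$ for every $m$, put $\psi^\sigma_m(\xi)=\psi^\sigma\big((\xi-a_m)/l_m\big)$ for $\sigma=1,2$, and for $f\in L^2(\mathbb R)$ let $$S^1f(x)=\big\{e^{-2\pi i\,a_mx}(\widehat f\,\psi^1_m)^\vee(x)\big\}_m,\qquad S^2f(x)=\big\{e^{-2\pi i\,b_mx}(\widehat f\,\psi^2_m)^\vee(x)\big\}_m.$$ Then for every $f\in L^2(\mathbb R)$ and every $x\in\mathbb R$, $$M_{r,2,s}(S^\sigma f)(x)\le C\,M_{i,2,s}f(x),\qquad \sigma=1,2.$$ -/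

import Mathlib

open MeasureTheory FourierTransform Set
open scoped ENNReal NNReal ContDiff

noncomputable section

/-- The local maximal function `M_{i,p,s} h` on the real line of a finite or countable collection
`h = (h_m)` of measurable functions:
`sup_{Q ∋ x} inf_P |Q|^{-s} (|Q|⁻¹ ∫_Q |h - P|_{ℓ²}^p)^{1/p}`,
with `Q = [c, d]` running over the nondegenerate compact intervals that contain `x`, and
`P = (P_m)` over all the collections of polynomials of degree strictly less than `i`.
It is `[0, ∞]`-valued; neither `h` nor `P` is assumed to take values in `ℓ²`. -/
def campanatoMax {ι : Type*} (i : ℕ) (p s : ℝ) (h : ι → ℝ → ℂ) (x : ℝ) : ℝ≥0∞ :=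
  ⨆ (c : ℝ) (d : ℝ) (_ : c < d) (_ : x ∈ Icc c d),
    ⨅ P : ι → Polynomial.degreeLT ℂ i,
      ENNReal.ofReal (d - c) ^ (-s) *
        ((ENNReal.ofReal (d - c))⁻¹ *
          ∫⁻ t in Icc c d,
            (∑' m, ‖h m t - (P m : Polynomial ℂ).eval (t : ℂ)‖ₑ ^ (2 : ℝ)) ^ (p / 2)) ^ (1 / p)

/-- The maximal function `M_{i,p,s} f` of a scalar-valued function: the collection `{f}`. -/
def campanatoMaxScalar (i : ℕ) (p s : ℝ) (f : ℝ → ℂ) (x : ℝ) : ℝ≥0∞ :=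
  campanatoMax i p s (fun _ : Unit => f) x

open Classical in
/-- The Fourier multiplier operator `f ↦ (f̂ · w)^∨` on `L²(ℝ)`, with the Fourier transform
`f̂(ξ) = ∫ e^{-2πi xξ} f(x) dx` extended to `L²` as a unitary operator. The symbol `w` is meant to be
a bounded measurable function, for which `f̂ · w` always lies in `L²`
(`memLp_fourier_mul_of_bound`); the value `0` is used when `f̂ · w` is not in `L²`. -/
def fourierMultiplier (w : ℝ → ℂ) (f : Lp ℂ 2 (volume : Measure ℝ)) :
    Lp ℂ 2 (volume : Measure ℝ) :=
  if hw : MemLp (fun ξ => (𝓕 f : Lp ℂ 2 (volume : Measure ℝ)) ξ * w ξ) 2 (volume : Measure ℝ) then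
    𝓕⁻ (hw.toLp (fun ξ => (𝓕 f : Lp ℂ 2 (volume : Measure ℝ)) ξ * w ξ))
  else 0

theorem memLp_fourier_mul_of_bound {w : ℝ → ℂ} (hm : AEStronglyMeasurable w volume) {K : ℝ}
    (hb : ∀ ξ, ‖w ξ‖ ≤ K) (f : Lp ℂ 2 (volume : Measure ℝ)) :
    MemLp (fun ξ => (𝓕 f : Lp ℂ 2 (volume : Measure ℝ)) ξ * w ξ) 2 (volume : Measure ℝ) := by
  have h := (Lp.memLp (𝓕 f : Lp ℂ 2 (volume : Measure ℝ)))
  refine h.of_le_mul (c := K) (h.1.mul hm) (Filter.Eventually.of_forall fun ξ => ?_)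
  rw [norm_mul, mul_comm]
  exact mul_le_mul_of_nonneg_right (hb ξ) (norm_nonneg _)

/-- The function `ψ`, which lives on `[0, 1]`, transplanted to the interval `[a, b]`:
`ξ ↦ ψ((ξ - a) / (b - a))`. -/
def transplant (ψ : ℝ → ℂ) (a b : ℝ) (ξ : ℝ) : ℂ :=
  ψ ((ξ - a) / (b - a))

/-- The operator `S¹ f = { e^{-2πi a_m x} (f̂ ψ_m)^∨(x) }_m`, with `ψ_m` the transplant of `ψ` to
`[a_m, b_m]`; the frequencies are shifted by the left ends. -/
def opS₁ {ι : Type*} (ψ : ℝ → ℂ) (a b : ι → ℝ) (f : Lp ℂ 2 (volume : Measure ℝ)) :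
    ι → ℝ → ℂ := fun m x =>
  Complex.exp (-2 * Real.pi * Complex.I * (a m : ℂ) * (x : ℂ)) *
    fourierMultiplier (transplant ψ (a m) (b m)) f x

/-- The operator `S² f = { e^{-2πi b_m x} (f̂ ψ_m)^∨(x) }_m`, with `ψ_m` the transplant of `ψ` to
`[a_m, b_m]`; the frequencies are shifted by the right ends. -/
def opS₂ {ι : Type*} (ψ : ℝ → ℂ) (a b : ι → ℝ) (f : Lp ℂ 2 (volume : Measure ℝ)) :
    ι → ℝ → ℂ := fun m x =>
  Complex.exp (-2 * Real.pi * Complex.I * (b m : ℂ) * (x : ℂ)) *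
    fourierMultiplier (transplant ψ (a m) (b m)) f x

end

/-! ### Fourier transform and multipliers on L² -/

noncomputable section

/-! Reflecting `t ↦ 1 - t` and allowing segments of negative length turns S² into S¹. So consider
one profile θ, smooth on [0, 1], vanishing beyond 2/3, with a possible jump at 0, transplanted to
disjoint segments from e_m to e_m + l_m, with the frequency e_m moved to the origin.

Fix an interval Q of length L that contains x and a number B above the maximal function of f at x.
On every dilate 2^k Q some polynomial p_k of degree < i is within B (2^k L)^{s+1/2} of f in L².
Comparing consecutive p_k shows that p_0 serves on all dilates, with error at most a constant times
B (k+1) 2^{k(μ+1/2)} L^{s+1/2}, where μ = max(s, i-1) (`exists_eLpNorm_sub_polynomial_le`). With a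
smooth cut-off η_N around Q at a large scale N, split f = (f - p_0) η_N + p_0 η_N + f (1 - η_N), and
measure the distance in L²(Q; ℓ²) of the image of each term from polynomials of degree < r.

The first term is cut into dyadic annuli. If G lives at distance at least R from a point, the ℓ²
norm there of the r-th derivatives of the image of G is at most a constant times R^{-r-1/2} ‖G‖₂
(`IsProfile.exists_bound_tsum_segDeriv`). Indeed each derivative is an integral of (ξ - e)^r θ((ξ -
e)/l) against the Fourier transform Φ of G centred at the point. As G stays away from the point, Φ
has repeated antiderivatives Φ_j with L² norm at most R^{-j} ‖G‖₂. After r + 1 integrations by parts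
the power (ξ - e)^r has absorbed the jump of θ in all boundary terms but the last, which a Sobolev
inequality at scale 1/R bounds; segments shorter than 1/R need only Cauchy-Schwarz. Disjointness
makes the sum over segments an L² norm on the line. Taylor expansion on Q then gives the factor
2^{-k(r+1/2)} for the k-th annulus, and the sum converges because r > μ.

In the second term the Fourier transform of p_0 η_N concentrates at 0. No segment contains 0 inside,
so |ξ - e_m| ≤ 2|ξ| where the symbol lives, and the r-th derivatives are bounded by the integral of
|ξ|^r times that transform, which is O(1/N) because deg p_0 < r. The third term tends to 0 by
Plancherel, since f is in L². Let N tend to infinity. -/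

/-- Both sides are locally integrable and agree against test functions: the Fourier transform moves
onto the test function, on the left by the distributional definition and on the right by Fubini. -/
theorem fourier_toLp_ae_eq {g : ℝ → ℂ} (h1 : Integrable g) (h2 : MemLp g 2) :
    (𝓕 (h2.toLp g) : Lp ℂ 2 (volume : Measure ℝ)) =ᵐ[volume] 𝓕 g := by
  have hc : Continuous (𝓕 g) := by
    have := VectorFourier.fourierIntegral_continuous (μ := volume) Real.continuous_fourierChar
      (L := innerₗ ℝ) (by exact continuous_inner) h1
    exact this
  refine ae_eq_of_integral_contDiff_smul_eq ?_ hc.locallyIntegrable ?_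
  · exact (Lp.memLp _).locallyIntegrable (by norm_num)
  intro φ hφ hs
  let Φ : SchwartzMap ℝ ℂ := HasCompactSupport.toSchwartzMap (f := fun x => (φ x : ℂ))
    (hs.comp_left (g := fun x : ℝ => (x : ℂ)) (by simp)) (by
      exact Complex.ofRealCLM.contDiff.comp hφ)
  have key := congrArg (fun T => T Φ) (Lp.fourier_toTemperedDistribution_eq (h2.toLp g))
  simp only [TemperedDistribution.fourier_apply, Lp.toTemperedDistribution_apply] at key
  have e1 : ∀ x, φ x • (𝓕 (h2.toLp g) : Lp ℂ 2 (volume : Measure ℝ)) x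
      = Φ x • (𝓕 (h2.toLp g) : Lp ℂ 2 (volume : Measure ℝ)) x := by
    intro x; simp [Φ]; exact Or.inl rfl
  have e2 : ∀ x, φ x • 𝓕 g x = Φ x * 𝓕 g x := by
    intro x; simp [Φ]; exact Or.inl rfl
  simp_rw [e1, e2]
  rw [← key]
  have := VectorFourier.integral_fourierIntegral_smul_eq_flip (μ := volume) (ν := volume)
    (L := innerₗ ℝ) Real.continuous_fourierChar (by exact continuous_inner)
    Φ.integrable h1
  have e3 : ∫ x, (𝓕 Φ) x • (h2.toLp g) x = ∫ x, (𝓕 Φ) x • g x := by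
    refine integral_congr_ae ?_
    filter_upwards [h2.coeFn_toLp] with x hx
    rw [hx]
  rw [e3]
  have e4 : (innerₗ ℝ : ℝ →ₗ[ℝ] ℝ →ₗ[ℝ] ℝ).flip = innerₗ ℝ := by
    ext; simp
  rw [e4] at this
  exact this

theorem fourierInv_toLp_ae_eq {g : ℝ → ℂ} (h1 : Integrable g) (h2 : MemLp g 2) :
    (𝓕⁻ (h2.toLp g) : Lp ℂ 2 (volume : Measure ℝ)) =ᵐ[volume] 𝓕⁻ g := by
  have hL : Continuous fun p : ℝ × ℝ => (-innerₗ ℝ : ℝ →ₗ[ℝ] ℝ →ₗ[ℝ] ℝ) p.1 p.2 := by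
    simp only [LinearMap.neg_apply, innerₗ_apply_apply]
    exact continuous_inner.neg
  have hc : Continuous (𝓕⁻ g) :=
    VectorFourier.fourierIntegral_continuous (μ := volume) Real.continuous_fourierChar
      (L := -innerₗ ℝ) hL h1
  refine ae_eq_of_integral_contDiff_smul_eq ?_ hc.locallyIntegrable ?_
  · exact (Lp.memLp _).locallyIntegrable (by norm_num)
  intro φ hφ hs
  let Φ : SchwartzMap ℝ ℂ := HasCompactSupport.toSchwartzMap (f := fun x => (φ x : ℂ))
    (hs.comp_left (g := fun x : ℝ => (x : ℂ)) (by simp)) (by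
      exact Complex.ofRealCLM.contDiff.comp hφ)
  have key := congrArg (fun T => T Φ) (Lp.fourierInv_toTemperedDistribution_eq (h2.toLp g))
  simp only [TemperedDistribution.fourierInv_apply, Lp.toTemperedDistribution_apply] at key
  have e1 : ∀ x, φ x • (𝓕⁻ (h2.toLp g) : Lp ℂ 2 (volume : Measure ℝ)) x
      = Φ x • (𝓕⁻ (h2.toLp g) : Lp ℂ 2 (volume : Measure ℝ)) x := by
    intro x; simp [Φ]; exact Or.inl rfl
  have e2 : ∀ x, φ x • 𝓕⁻ g x = Φ x * 𝓕⁻ g x := by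
    intro x; simp [Φ]; exact Or.inl rfl
  simp_rw [e1, e2]
  rw [← key]
  have := VectorFourier.integral_fourierIntegral_smul_eq_flip (μ := volume) (ν := volume)
    (L := -innerₗ ℝ) Real.continuous_fourierChar hL Φ.integrable h1
  have e3 : ∫ x, (𝓕⁻ Φ) x • (h2.toLp g) x = ∫ x, (𝓕⁻ Φ) x • g x := by
    refine integral_congr_ae ?_
    filter_upwards [h2.coeFn_toLp] with x hx
    rw [hx]
  rw [e3]
  have e4 : (-innerₗ ℝ : ℝ →ₗ[ℝ] ℝ →ₗ[ℝ] ℝ).flip = -innerₗ ℝ := by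
    ext; simp
  rw [e4] at this
  simp only [SchwartzMap.fourierInv_coe]
  exact this

theorem lintegral_enorm_rpow_two_eq (G : Lp ℂ 2 (volume : Measure ℝ)) :
    ∫⁻ x, ‖G x‖ₑ ^ (2 : ℝ) = ‖G‖ₑ ^ (2 : ℝ) := by
  rw [Lp.enorm_def, eLpNorm_eq_lintegral_rpow_enorm_toReal (by norm_num) (by norm_num)]
  simp only [ENNReal.toReal_ofNat]
  rw [← ENNReal.rpow_mul]
  norm_num

theorem lintegral_fourier_enorm_rpow_two (G : Lp ℂ 2 (volume : Measure ℝ)) :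
    ∫⁻ ξ, ‖(𝓕 G : Lp ℂ 2 (volume : Measure ℝ)) ξ‖ₑ ^ (2 : ℝ) = ∫⁻ x, ‖G x‖ₑ ^ (2 : ℝ) := by
  rw [lintegral_enorm_rpow_two_eq, lintegral_enorm_rpow_two_eq, ← ofReal_norm, ← ofReal_norm,
    Lp.norm_fourier_eq]

theorem lintegral_fourierInv_enorm_rpow_two (G : Lp ℂ 2 (volume : Measure ℝ)) :
    ∫⁻ ξ, ‖(𝓕⁻ G : Lp ℂ 2 (volume : Measure ℝ)) ξ‖ₑ ^ (2 : ℝ) = ∫⁻ x, ‖G x‖ₑ ^ (2 : ℝ) := by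
  rw [← lintegral_fourier_enorm_rpow_two, fourier_fourierInv_eq]

/-- Plancherel for integrable square integrable functions. -/
theorem lintegral_fourierIntegral_enorm_rpow_two {g : ℝ → ℂ} (h1 : Integrable g)
    (h2 : MemLp g 2) : ∫⁻ ξ, ‖𝓕 g ξ‖ₑ ^ (2 : ℝ) = ∫⁻ x, ‖g x‖ₑ ^ (2 : ℝ) := by
  have h := lintegral_fourier_enorm_rpow_two (h2.toLp g)
  have e1 : ∫⁻ ξ, ‖𝓕 g ξ‖ₑ ^ (2 : ℝ) =
      ∫⁻ ξ, ‖(𝓕 (h2.toLp g) : Lp ℂ 2 (volume : Measure ℝ)) ξ‖ₑ ^ (2 : ℝ) := by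
    refine lintegral_congr_ae ?_
    filter_upwards [fourier_toLp_ae_eq h1 h2] with x hx
    rw [hx]
  rw [e1, h]
  refine lintegral_congr_ae ?_
  filter_upwards [h2.coeFn_toLp] with x hx
  rw [hx]

/-- A bounded measurable symbol. -/
structure IsBoundedSymbol (w : ℝ → ℂ) (K : ℝ) : Prop where
  aesm : AEStronglyMeasurable w volume
  bound : ∀ ξ, ‖w ξ‖ ≤ K

theorem fourierMultiplier_eq {w : ℝ → ℂ} {K : ℝ} (hw : IsBoundedSymbol w K)
    (G : Lp ℂ 2 (volume : Measure ℝ)) :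
    fourierMultiplier w G = 𝓕⁻ ((memLp_fourier_mul_of_bound hw.aesm hw.bound G).toLp
      (fun ξ => (𝓕 G : Lp ℂ 2 (volume : Measure ℝ)) ξ * w ξ)) := by
  rw [fourierMultiplier, dif_pos]

theorem fourierMultiplier_add {w : ℝ → ℂ} {K : ℝ} (hw : IsBoundedSymbol w K)
    (G H : Lp ℂ 2 (volume : Measure ℝ)) :
    fourierMultiplier w (G + H) = fourierMultiplier w G + fourierMultiplier w H := by
  rw [fourierMultiplier_eq hw, fourierMultiplier_eq hw, fourierMultiplier_eq hw, ← fourierInv_add,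
    ← MemLp.toLp_add]
  congr 1
  rw [MemLp.toLp_eq_toLp_iff]
  rw [FourierTransform.fourier_add]
  filter_upwards [Lp.coeFn_add (𝓕 G : Lp ℂ 2 (volume : Measure ℝ)) (𝓕 H)] with x hx
  rw [Pi.add_apply, hx, Pi.add_apply, add_mul]

theorem lintegral_fourierMultiplier {w : ℝ → ℂ} {K : ℝ} (hw : IsBoundedSymbol w K)
    (G : Lp ℂ 2 (volume : Measure ℝ)) :
    ∫⁻ x, ‖fourierMultiplier w G x‖ₑ ^ (2 : ℝ) =
      ∫⁻ ξ, ‖(𝓕 G : Lp ℂ 2 (volume : Measure ℝ)) ξ * w ξ‖ₑ ^ (2 : ℝ) := by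
  rw [fourierMultiplier_eq hw, lintegral_fourierInv_enorm_rpow_two]
  refine lintegral_congr_ae ?_
  filter_upwards [(memLp_fourier_mul_of_bound hw.aesm hw.bound G).coeFn_toLp] with x hx
  rw [hx]

theorem fourierMultiplier_ae_eq {w : ℝ → ℂ} {K : ℝ} (hw : IsBoundedSymbol w K)
    (G : Lp ℂ 2 (volume : Measure ℝ))
    (hi : Integrable fun ξ => (𝓕 G : Lp ℂ 2 (volume : Measure ℝ)) ξ * w ξ) :
    fourierMultiplier w G =ᵐ[volume]
      𝓕⁻ fun ξ => (𝓕 G : Lp ℂ 2 (volume : Measure ℝ)) ξ * w ξ := by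
  rw [fourierMultiplier_eq hw]
  exact fourierInv_toLp_ae_eq hi _

end

/-! ### One-dimensional calculus: integration by parts, Sobolev, Taylor -/

noncomputable section

/-- Repeated integration by parts against `t ^ r * θ t`, for `θ` smooth on `[0, 1]` and vanishing
near `1`: only the boundary term of order `r + 1` at `0` survives. -/
theorem exists_bound_integral_pow_mul (r : ℕ) : ∀ θ : ℝ → ℂ, ContDiffOn ℝ ∞ θ (Icc 0 1) →
    (∀ t ∈ Ioc (2 / 3 : ℝ) 1, θ t = 0) → ∃ K : ℝ, 0 ≤ K ∧ ∀ F : ℕ → ℝ → ℂ, Continuous (F 0) →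
      (∀ j t, HasDerivAt (F (j + 1)) (F j t) t) →
      ‖∫ t in (0 : ℝ)..1, (t : ℂ) ^ r * θ t * F 0 t‖ ≤
        K * (‖F (r + 1) 0‖ + ∫ t in (0 : ℝ)..1, ‖F (r + 1) t‖) := by
  have hU : UniqueDiffOn ℝ (Icc (0 : ℝ) 1) := uniqueDiffOn_Icc zero_lt_one
  have hI : uIcc (0 : ℝ) 1 = Icc 0 1 := uIcc_of_le zero_le_one
  have hvan : ∀ θ : ℝ → ℂ, (∀ t ∈ Ioc (2 / 3 : ℝ) 1, θ t = 0) →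
      ∀ t ∈ Ioc (2 / 3 : ℝ) 1, derivWithin θ (Icc 0 1) t = 0 := by
    intro θ h t ht
    have : θ =ᶠ[nhdsWithin t (Icc 0 1)] fun _ => 0 := by
      filter_upwards [self_mem_nhdsWithin, mem_nhdsWithin_of_mem_nhds (Ioi_mem_nhds ht.1)] with u h1 h2
      exact h u ⟨h2, h1.2⟩
    rw [this.derivWithin_eq (h t ht)]
    simp
  have hder : ∀ θ : ℝ → ℂ, ContDiffOn ℝ ∞ θ (Icc 0 1) → ∀ t ∈ Icc (0 : ℝ) 1,
      HasDerivWithinAt θ (derivWithin θ (Icc 0 1) t) (Icc 0 1) t := fun θ hθ t ht =>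
    ((hθ.differentiableOn (by simp)) t ht).hasDerivWithinAt
  induction r with
  | zero =>
    intro θ hθ hv
    have hθ' := (contDiffOn_infty_iff_derivWithin hU).1 hθ
    obtain ⟨K₁, hK₁⟩ := isCompact_Icc.exists_bound_of_continuousOn hθ'.2.continuousOn
    refine ⟨max K₁ ‖θ 0‖, le_max_of_le_right (norm_nonneg _), fun F hF0 hF => ?_⟩
    have hFc : Continuous (F 1) := continuous_iff_continuousAt.2 fun t => (hF 0 t).continuousAt
    have hib := intervalIntegral.integral_mul_deriv_eq_deriv_mul_of_hasDerivWithinAt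
      (a := 0) (b := 1) (u := θ) (u' := derivWithin θ (Icc 0 1)) (v := F 1) (v' := F 0)
      (by rw [hI]; exact hder θ hθ) (fun t _ => (hF 0 t).hasDerivWithinAt)
      (by apply ContinuousOn.intervalIntegrable; rw [hI]; exact hθ'.2.continuousOn)
      (hF0.intervalIntegrable _ _)
    simp only [pow_zero, one_mul]
    rw [hib, hv 1 (by norm_num), zero_mul, zero_sub]
    have h1 : ‖∫ t in (0 : ℝ)..1, derivWithin θ (Icc 0 1) t * F 1 t‖ ≤
        ∫ t in (0 : ℝ)..1, max K₁ ‖θ 0‖ * ‖F 1 t‖ := by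
      apply intervalIntegral.norm_integral_le_of_norm_le zero_le_one
      · refine Filter.Eventually.of_forall fun t ht => ?_
        rw [norm_mul]
        exact mul_le_mul_of_nonneg_right ((hK₁ t ⟨ht.1.le, ht.2⟩).trans (le_max_left _ _))
          (norm_nonneg _)
      · exact (continuous_const.mul hFc.norm).intervalIntegrable _ _
    rw [intervalIntegral.integral_const_mul] at h1
    calc _ ≤ ‖-(θ 0 * F 1 0)‖ + ‖∫ t in (0 : ℝ)..1, derivWithin θ (Icc 0 1) t * F 1 t‖ :=
          norm_sub_le _ _
      _ ≤ max K₁ ‖θ 0‖ * ‖F 1 0‖ + max K₁ ‖θ 0‖ * ∫ t in (0 : ℝ)..1, ‖F 1 t‖ := by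
          refine add_le_add ?_ h1
          rw [norm_neg, norm_mul]
          exact mul_le_mul_of_nonneg_right (le_max_right _ _) (norm_nonneg _)
      _ = _ := by rw [zero_add]; ring
  | succ r ih =>
    intro θ hθ hv
    have hθ' := (contDiffOn_infty_iff_derivWithin hU).1 hθ
    -- The derivative of t^(r+1) θ is t^r times this new profile, which is again smooth and vanishes
    -- near 1. The boundary term at 0 is killed by the power of t.
    obtain ⟨K, hK0, hK⟩ := ih (fun t => (r + 1) * θ t + t * derivWithin θ (Icc 0 1) t)
      (by
        refine (contDiffOn_const.mul hθ).add (ContDiffOn.mul ?_ hθ'.2)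
        exact Complex.ofRealCLM.contDiff.contDiffOn)
      (fun t ht => by simp only [hv t ht, hvan θ hv t ht, mul_zero, add_zero])
    refine ⟨K, hK0, fun F hF0 hF => ?_⟩
    have hFc : Continuous (F 1) := continuous_iff_continuousAt.2 fun t => (hF 0 t).continuousAt
    have hib := intervalIntegral.integral_mul_deriv_eq_deriv_mul_of_hasDerivWithinAt
      (a := 0) (b := 1) (u := fun t => (t : ℂ) ^ (r + 1) * θ t)
      (u' := fun t => (t : ℂ) ^ r * ((r + 1) * θ t + t * derivWithin θ (Icc 0 1) t))
      (v := F 1) (v' := F 0)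
      (by
        rw [hI]
        intro t ht
        have h1 : HasDerivAt (fun t : ℝ => (t : ℂ) ^ (r + 1)) ((r + 1) * (t : ℂ) ^ r) t := by
          have := (Complex.ofRealCLM.hasDerivAt (x := t)).fun_pow (r + 1)
          simpa using this
        refine (h1.hasDerivWithinAt.mul (hder θ hθ t ht)).congr_deriv ?_
        ring)
      (fun t _ => (hF 0 t).hasDerivWithinAt)
      (by
        apply ContinuousOn.intervalIntegrable
        rw [hI]
        have hc : ContinuousOn (fun t : ℝ => (t : ℂ)) (Icc 0 1) :=
          Complex.continuous_ofReal.continuousOn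
        exact (hc.pow r).mul ((continuousOn_const.mul hθ.continuousOn).add
          (hc.mul hθ'.2.continuousOn)))
      (hF0.intervalIntegrable _ _)
    rw [hib, hv 1 (by norm_num)]
    have h2 := hK (fun j => F (j + 1)) hFc (fun j t => hF (j + 1) t)
    simp only [zero_add] at h2
    simpa using h2

/-- Cauchy-Schwarz, from the nonnegativity of the variance of u on [0, τ]. -/
theorem sq_integral_le_mul_integral_sq {τ : ℝ} (hτ : 0 < τ) {u : ℝ → ℝ} (hu : Continuous u) :
    (∫ t in (0 : ℝ)..τ, u t) ^ 2 ≤ τ * ∫ t in (0 : ℝ)..τ, u t ^ 2 := by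
  set M := (∫ t in (0 : ℝ)..τ, u t) with hM
  have h0 : 0 ≤ ∫ t in (0 : ℝ)..τ, (u t - M / τ) ^ 2 :=
    intervalIntegral.integral_nonneg hτ.le fun t _ => sq_nonneg _
  have h1 : ∫ t in (0 : ℝ)..τ, (u t - M / τ) ^ 2 =
      (∫ t in (0 : ℝ)..τ, u t ^ 2) - M ^ 2 / τ := by
    have : ∀ t, (u t - M / τ) ^ 2 = (u t ^ 2 - 2 * (M / τ) * u t) + (M / τ) ^ 2 := by
      intro t; ring
    simp_rw [this]
    rw [intervalIntegral.integral_add, intervalIntegral.integral_sub,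
      intervalIntegral.integral_const_mul, ← hM, intervalIntegral.integral_const]
    · simp only [sub_zero, smul_eq_mul]; field_simp; ring
    all_goals apply Continuous.intervalIntegrable; fun_prop
  rw [h1] at h0
  have := mul_le_mul_of_nonneg_left (sub_nonneg.1 h0) hτ.le
  rwa [mul_div_cancel₀ _ hτ.ne'] at this

/-- A one-dimensional Sobolev inequality at scale `τ ≤ 1`. -/
theorem norm_sq_zero_le_integral {τ : ℝ} (hτ : 0 < τ) (hτ1 : τ ≤ 1) {F F' : ℝ → ℂ}
    (hF' : Continuous F') (hF : ∀ t, HasDerivAt F (F' t) t) :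
    ‖F 0‖ ^ 2 ≤ 2 / τ * (∫ t in (0 : ℝ)..1, ‖F t‖ ^ 2) +
      2 * τ * ∫ t in (0 : ℝ)..1, ‖F' t‖ ^ 2 := by
  have hFc : Continuous F := continuous_iff_continuousAt.2 fun t => (hF t).continuousAt
  have hmono : ∀ u : ℝ → ℂ, Continuous u →
      ∫ t in (0 : ℝ)..τ, ‖u t‖ ^ 2 ≤ ∫ t in (0 : ℝ)..1, ‖u t‖ ^ 2 := by
    intro u hu
    refine intervalIntegral.integral_mono_interval le_rfl hτ.le hτ1 ?_ ?_
    · exact Filter.Eventually.of_forall fun t => sq_nonneg _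
    · apply Continuous.intervalIntegrable; fun_prop
  -- The integrand is the derivative of (t/τ - 1) F, whose weight is -1 at 0 and 0 at τ.
  have h1 : ∫ t in (0 : ℝ)..τ, ((1 / τ : ℂ) * F t + ((t / τ - 1 : ℝ) : ℂ) * F' t) = F 0 := by
    have hd : ∀ t ∈ uIcc 0 τ, HasDerivAt (fun t : ℝ => ((t / τ - 1 : ℝ) : ℂ) * F t)
        ((1 / τ : ℂ) * F t + ((t / τ - 1 : ℝ) : ℂ) * F' t) t := by
      intro t _
      have h2 : HasDerivAt (fun t : ℝ => ((t / τ - 1 : ℝ) : ℂ)) ((1 / τ : ℝ) : ℂ) t :=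
        (((hasDerivAt_id t).div_const τ).sub_const 1).ofReal_comp
      have := h2.fun_mul (hF t)
      simpa using this
    rw [intervalIntegral.integral_eq_sub_of_hasDerivAt hd]
    · simp [div_self hτ.ne']
    · apply Continuous.intervalIntegrable; fun_prop
  have h2 : ‖F 0‖ ≤ ∫ t in (0 : ℝ)..τ, (1 / τ * ‖F t‖ + ‖F' t‖) := by
    rw [← h1]
    apply intervalIntegral.norm_integral_le_of_norm_le hτ.le
    · refine Filter.Eventually.of_forall fun t ht => (norm_add_le _ _).trans ?_
      rw [norm_mul, norm_mul, Complex.norm_real]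
      have : ‖t / τ - 1‖ ≤ 1 := by
        rw [Real.norm_eq_abs, abs_le]
        have h3 : 0 ≤ t / τ := div_nonneg ht.1.le hτ.le
        have h4 : t / τ ≤ 1 := (div_le_one hτ).2 ht.2
        constructor <;> linarith
      gcongr
      · simp [abs_of_pos hτ]
      · exact mul_le_of_le_one_left (norm_nonneg _) this
    · apply Continuous.intervalIntegrable; fun_prop
  rw [intervalIntegral.integral_add (by apply Continuous.intervalIntegrable; fun_prop)
    (by apply Continuous.intervalIntegrable; fun_prop), intervalIntegral.integral_const_mul] at h2
  have h3 := sq_integral_le_mul_integral_sq hτ hFc.norm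
  have h4 := sq_integral_le_mul_integral_sq hτ hF'.norm
  have h5 := hmono F hFc
  have h6 := hmono F' hF'
  set A := ∫ t in (0 : ℝ)..τ, ‖F t‖
  set B := ∫ t in (0 : ℝ)..τ, ‖F' t‖
  calc ‖F 0‖ ^ 2 ≤ (1 / τ * A + B) ^ 2 := by gcongr
    _ ≤ 2 * ((1 / τ) ^ 2 * A ^ 2 + B ^ 2) := by nlinarith [sq_nonneg (1 / τ * A - B)]
    _ ≤ 2 * ((1 / τ) ^ 2 * (τ * ∫ t in (0 : ℝ)..1, ‖F t‖ ^ 2) +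
        τ * ∫ t in (0 : ℝ)..1, ‖F' t‖ ^ 2) := by
      gcongr
      · exact h3.trans (by gcongr)
      · exact h4.trans (by gcongr)
    _ = _ := by field_simp

/-- Induction with the mean value inequality: the derivative of the remainder of order r + 1 is the
remainder of order r of the shifted sequence. The factor 1/r! is given up. Vector values allow one
bound for many functions in ℓ² at once. -/
theorem norm_sub_taylor_le {E : Type*} [NormedAddCommGroup E] [NormedSpace ℝ E] {c d D : ℝ}
    (r : ℕ) : ∀ U : ℕ → ℝ → E, (∀ j y, HasDerivAt (U j) (U (j + 1) y) y) →
      (∀ y ∈ Icc c d, ‖U r y‖ ≤ D) → ∀ y ∈ Icc c d,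
      ‖U 0 y - ∑ j ∈ Finset.range r, ((y - c) ^ j / (j.factorial : ℝ)) • U j c‖ ≤
        D * (d - c) ^ r := by
  induction r with
  | zero =>
    intro U _ hD y hy
    simpa using hD y hy
  | succ r ih =>
    intro U hU hD y hy
    have h1 := ih (fun j => U (j + 1)) (fun j => hU (j + 1)) hD
    set W : ℝ → E := fun y => U 0 y -
      ∑ j ∈ Finset.range (r + 1), ((y - c) ^ j / (j.factorial : ℝ)) • U j c with hW
    have hWd : ∀ y ∈ Icc c d, HasDerivWithinAt W (U 1 y -
        ∑ j ∈ Finset.range r, ((y - c) ^ j / (j.factorial : ℝ)) • U (j + 1) c) (Icc c d) y := by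
      intro y _
      refine HasDerivAt.hasDerivWithinAt ?_
      refine (hU 0 y).sub ?_
      simp_rw [Finset.sum_range_succ' _ r]
      simp only [pow_zero, Nat.factorial_zero, Nat.cast_one, div_one, one_smul]
      refine HasDerivAt.add_const _ (HasDerivAt.fun_sum fun j _ => ?_)
      refine HasDerivAt.smul_const ?_ _
      refine ((((hasDerivAt_id y).sub_const c).pow (j + 1)).div_const _).congr_deriv ?_
      have : (j.factorial : ℝ) ≠ 0 := by positivity
      have : (j : ℝ) + 1 ≠ 0 := by positivity
      simp only [Nat.factorial_succ, Nat.cast_mul, Nat.cast_add, Nat.cast_one, id,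
        add_tsub_cancel_right]
      field_simp
    have h0 : W c = 0 := by
      simp only [hW, Finset.sum_range_succ' _ r, sub_self]
      simp
    have hcd : c ≤ d := hy.1.trans hy.2
    have hD0 : 0 ≤ D * (d - c) ^ r := (norm_nonneg _).trans (h1 y hy)
    have h2 := norm_image_sub_le_of_norm_deriv_le_segment' hWd
      (fun x hx => h1 x (Ico_subset_Icc_self hx)) y hy
    rw [h0, sub_zero] at h2
    refine h2.trans ?_
    rw [pow_succ, ← mul_assoc]
    gcongr
    exact hy.2

end

/-! ### Profiles, segments and the smooth representatives of the multipliers -/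

noncomputable section

theorem enorm_rpow_two (z : ℂ) : ‖z‖ₑ ^ (2 : ℝ) = ENNReal.ofReal (‖z‖ ^ 2) := by
  rw [← ofReal_norm, ENNReal.ofReal_rpow_of_nonneg (norm_nonneg _) (by norm_num), Real.rpow_two]

/-- A profile: a bounded function that lives on `[0, 2/3]` and is smooth on `[0, 1]`, with a
possible jump at `0`. -/
structure IsProfile (θ : ℝ → ℂ) (K : ℝ) : Prop where
  smooth : ContDiffOn ℝ ∞ θ (Icc 0 1)
  support : Function.support θ ⊆ Icc 0 (2 / 3)
  bound : ∀ t, ‖θ t‖ ≤ K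

/-- The segment with the end points `e` and `e + l`. -/
def segmentSet (e l : ℝ) : Set ℝ := {ξ | (ξ - e) / l ∈ Icc (0 : ℝ) 1}

/-- The profile `θ` moved to the segment with the end points `e` and `e + l`. -/
def segSymbol (θ : ℝ → ℂ) (e l ξ : ℝ) : ℂ := θ ((ξ - e) / l)

/-- A family of pairwise disjoint segments, whose initial two thirds keep away from `0`. -/
structure IsSegmentFamily {ι : Type*} (e l : ι → ℝ) : Prop where
  ne : ∀ m, l m ≠ 0
  disj : Pairwise (Function.onFun Disjoint fun m => segmentSet (e m) (l m))
  away : ∀ m, ∀ t ∈ Icc (0 : ℝ) (2 / 3), |l m * t| ≤ 2 * |e m + l m * t|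

/-- The demodulated Fourier multipliers with the symbols `segSymbol θ (e m) (l m)`. -/
def segOp {ι : Type*} (θ : ℝ → ℂ) (e l : ι → ℝ) (G : Lp ℂ 2 (volume : Measure ℝ)) (m : ι)
    (y : ℝ) : ℂ :=
  Complex.exp (-2 * Real.pi * Complex.I * (e m : ℂ) * (y : ℂ)) *
    fourierMultiplier (segSymbol θ (e m) (l m)) G y

variable {ι : Type*} {θ : ℝ → ℂ} {K : ℝ} {e l : ι → ℝ}

theorem measurableSet_segmentSet (e l : ℝ) : MeasurableSet (segmentSet e l) :=
  measurableSet_Icc.preimage (by fun_prop)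

theorem IsProfile.measurable (hθ : IsProfile θ K) : Measurable θ := by
  have : θ = (Icc (0 : ℝ) 1).indicator θ := by
    refine (Set.indicator_eq_self.2 (hθ.support.trans ?_)).symm
    exact Icc_subset_Icc_right (by norm_num)
  rw [this, ← Set.piecewise_eq_indicator]
  exact ContinuousOn.measurable_piecewise hθ.smooth.continuousOn continuousOn_const
    measurableSet_Icc

theorem IsProfile.isBoundedSymbol (hθ : IsProfile θ K) (e l : ℝ) :
    IsBoundedSymbol (segSymbol θ e l) K where
  aesm := by
    have : Measurable fun ξ : ℝ => (ξ - e) / l := by fun_prop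
    exact (hθ.measurable.comp this).aestronglyMeasurable
  bound ξ := hθ.bound _

theorem IsProfile.segSymbol_eq_zero (hθ : IsProfile θ K) {e l ξ : ℝ} (h : ξ ∉ segmentSet e l) :
    segSymbol θ e l ξ = 0 := by
  by_contra h0
  have := hθ.support h0
  exact h ⟨this.1, this.2.trans (by norm_num)⟩

theorem tsum_setLIntegral_le [Countable ι] {E : ι → Set ℝ} (hE : ∀ m, MeasurableSet (E m))
    (hd : Pairwise (Function.onFun Disjoint E)) (φ : ℝ → ℝ≥0∞) :
    ∑' m, ∫⁻ x in E m, φ x ≤ ∫⁻ x, φ x := by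
  rw [← lintegral_iUnion hE hd]
  exact setLIntegral_le_lintegral _ _

theorem norm_exp_demodulation (a y : ℝ) :
    ‖Complex.exp (-2 * Real.pi * Complex.I * (a : ℂ) * (y : ℂ))‖ = 1 := by
  have : (-2 * Real.pi * Complex.I * (a : ℂ) * (y : ℂ)) =
      ((-2 * Real.pi * a * y : ℝ) : ℂ) * Complex.I := by push_cast; ring
  rw [this, Complex.norm_exp_ofReal_mul_I]

/-- Plancherel puts each term on its own segment in frequency, and disjoint segments contribute at
most the full L² norm. -/
theorem lintegral_tsum_segOp_le [Countable ι] (hθ : IsProfile θ K) (hf : IsSegmentFamily e l)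
    (G : Lp ℂ 2 (volume : Measure ℝ)) :
    ∫⁻ y, ∑' m, ‖segOp θ e l G m y‖ₑ ^ (2 : ℝ) ≤
      ENNReal.ofReal (K ^ 2) * ∫⁻ y, ‖G y‖ₑ ^ (2 : ℝ) := by
  have h1 : ∀ m y, ‖segOp θ e l G m y‖ₑ ^ (2 : ℝ) =
      ‖fourierMultiplier (segSymbol θ (e m) (l m)) G y‖ₑ ^ (2 : ℝ) := by
    intro m y
    rw [enorm_rpow_two, enorm_rpow_two, segOp, norm_mul, norm_exp_demodulation, one_mul]
  simp_rw [h1]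
  rw [lintegral_tsum (fun m =>
    ((Lp.aestronglyMeasurable _).enorm.pow_const _))]
  simp_rw [lintegral_fourierMultiplier (hθ.isBoundedSymbol _ _)]
  calc _ ≤ ∑' m, ∫⁻ ξ in segmentSet (e m) (l m), ENNReal.ofReal (K ^ 2) *
        ‖(𝓕 G : Lp ℂ 2 (volume : Measure ℝ)) ξ‖ₑ ^ (2 : ℝ) := by
        refine ENNReal.tsum_le_tsum fun m => ?_
        rw [← lintegral_indicator (measurableSet_segmentSet _ _)]
        refine lintegral_mono fun ξ => ?_
        by_cases hξ : ξ ∈ segmentSet (e m) (l m)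
        · rw [indicator_of_mem hξ, enorm_rpow_two, enorm_rpow_two, ← ENNReal.ofReal_mul (sq_nonneg _),
            norm_mul, mul_pow, mul_comm]
          gcongr
          exact hθ.bound _
        · rw [hθ.segSymbol_eq_zero hξ]
          simp
    _ ≤ ∫⁻ ξ, ENNReal.ofReal (K ^ 2) *
        ‖(𝓕 G : Lp ℂ 2 (volume : Measure ℝ)) ξ‖ₑ ^ (2 : ℝ) :=
        tsum_setLIntegral_le (fun m => measurableSet_segmentSet _ _) hf.disj _
    _ = _ := by
        rw [lintegral_const_mul' _ _ ENNReal.ofReal_ne_top, lintegral_fourier_enorm_rpow_two]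

/-- The exponential integral `t ↦ ∫ φ(ξ) e^{iκ(ξ-a)t} dξ`. -/
def expIntegral (κ a : ℝ) (φ : ℝ → ℂ) (t : ℝ) : ℂ :=
  ∫ ξ, φ ξ * Complex.exp ((κ * (ξ - a) * t : ℝ) * Complex.I)

/-- The density of the derivative is a separate function, prescribed only almost everywhere. This
serves both to differentiate `segDeriv` and, read backwards, to recognise antiderivatives obtained
by dividing the density by y - x. -/
theorem hasDerivAt_expIntegral {κ a : ℝ} {φ φ' : ℝ → ℂ} (h : Integrable φ)
    (hφ' : φ' =ᵐ[volume] fun ξ => ((κ * (ξ - a) : ℝ) : ℂ) * Complex.I * φ ξ)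
    (h' : Integrable φ') (t : ℝ) :
    HasDerivAt (expIntegral κ a φ) (expIntegral κ a φ' t) t := by
  have hm : ∀ t : ℝ, AEStronglyMeasurable
      (fun ξ : ℝ => Complex.exp ((κ * (ξ - a) * t : ℝ) * Complex.I)) volume := fun t => by
    apply Continuous.aestronglyMeasurable
    fun_prop
  refine (hasDerivAt_integral_of_dominated_loc_of_deriv_le (s := univ) (bound := fun ξ => ‖φ' ξ‖)
    (F := fun t ξ => φ ξ * Complex.exp ((κ * (ξ - a) * t : ℝ) * Complex.I))
    (F' := fun t ξ => φ' ξ * Complex.exp ((κ * (ξ - a) * t : ℝ) * Complex.I))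
    Filter.univ_mem ?_ ?_ ?_ ?_ ?_ ?_).2
  · exact Filter.Eventually.of_forall fun t => h.1.mul (hm t)
  · refine h.mul_bdd (c := 1) (hm t) (Filter.Eventually.of_forall fun ξ => ?_)
    rw [Complex.norm_exp_ofReal_mul_I]
  · exact h'.1.mul (hm t)
  · refine Filter.Eventually.of_forall fun ξ t _ => ?_
    rw [norm_mul, Complex.norm_exp_ofReal_mul_I, mul_one]
  · exact h'.norm
  · filter_upwards [hφ'] with ξ hξ t _
    have h1 : HasDerivAt (fun t : ℝ => ((κ * (ξ - a) * t : ℝ) : ℂ) * Complex.I)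
        (((κ * (ξ - a) : ℝ) : ℂ) * Complex.I) t := by
      have := (((hasDerivAt_id t).const_mul (κ * (ξ - a))).ofReal_comp).mul_const Complex.I
      simpa using this
    refine (h1.cexp.const_mul (φ ξ)).congr_deriv ?_
    rw [hξ]
    ring

/-- The density whose exponential integral is the `j`-th derivative of `segOp`. -/
def segDensity (θ : ℝ → ℂ) (e l : ℝ) (G : Lp ℂ 2 (volume : Measure ℝ)) (j : ℕ) (ξ : ℝ) : ℂ :=
  (((2 * Real.pi * (ξ - e) : ℝ) : ℂ) * Complex.I) ^ j *
    ((𝓕 G : Lp ℂ 2 (volume : Measure ℝ)) ξ * segSymbol θ e l ξ)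

theorem norm_segDensity (θ : ℝ → ℂ) (e l : ℝ) (G : Lp ℂ 2 (volume : Measure ℝ)) (j : ℕ) (ξ : ℝ) :
    ‖segDensity θ e l G j ξ‖ = (2 * Real.pi * |ξ - e|) ^ j *
      (‖(𝓕 G : Lp ℂ 2 (volume : Measure ℝ)) ξ‖ * ‖segSymbol θ e l ξ‖) := by
  rw [segDensity, norm_mul, norm_mul, norm_pow, norm_mul, Complex.norm_real, Complex.norm_I,
    mul_one, Real.norm_eq_abs, abs_mul, abs_of_pos Real.two_pi_pos]

/-- The `j`-th derivative of `segOp`. -/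
def segDeriv (θ : ℝ → ℂ) (e l : ℝ) (G : Lp ℂ 2 (volume : Measure ℝ)) (j : ℕ) (y : ℝ) : ℂ :=
  expIntegral (2 * Real.pi) e (segDensity θ e l G j) y

theorem abs_sub_le_of_mem_segmentSet {e l ξ : ℝ} (hl : l ≠ 0) (h : ξ ∈ segmentSet e l) :
    |ξ - e| ≤ |l| := by
  have h2 : |(ξ - e) / l| ≤ 1 := abs_le.2 ⟨by linarith [h.1], h.2⟩
  rw [abs_div] at h2
  exact (div_le_one (abs_pos.2 hl)).1 h2

theorem volume_segmentSet_ne_top {e l : ℝ} (hl : l ≠ 0) : volume (segmentSet e l) ≠ ⊤ := by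
  have : segmentSet e l ⊆ Icc (e - |l|) (e + |l|) := fun ξ hξ => by
    have := abs_le.1 (abs_sub_le_of_mem_segmentSet hl hξ)
    constructor <;> linarith [this.1, this.2]
  exact ((measure_mono this).trans_lt (by rw [Real.volume_Icc]; exact ENNReal.ofReal_lt_top)).ne

theorem IsProfile.integrable_segDensity (hθ : IsProfile θ K) {e l : ℝ} (hl : l ≠ 0)
    (G : Lp ℂ 2 (volume : Measure ℝ)) (j : ℕ) : Integrable (segDensity θ e l G j) := by
  have h1 : IntegrableOn (𝓕 G : Lp ℂ 2 (volume : Measure ℝ)) (segmentSet e l) := by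
    have : IsFiniteMeasure (volume.restrict (segmentSet e l)) :=
      ⟨by rw [Measure.restrict_apply_univ]; exact (volume_segmentSet_ne_top hl).lt_top⟩
    exact ((Lp.memLp (𝓕 G : Lp ℂ 2 (volume : Measure ℝ))).restrict _).integrable (by norm_num)
  have h2 : Integrable ((segmentSet e l).indicator (𝓕 G : Lp ℂ 2 (volume : Measure ℝ))) :=
    (integrable_indicator_iff (measurableSet_segmentSet _ _)).2 h1
  refine (h2.const_mul (((2 * Real.pi * |l|) ^ j * K : ℝ) : ℂ)).mono ?_ ?_
  · refine AEStronglyMeasurable.mul ?_ ((Lp.aestronglyMeasurable _).mul (hθ.isBoundedSymbol e l).aesm)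
    apply Continuous.aestronglyMeasurable
    fun_prop
  · refine Filter.Eventually.of_forall fun ξ => ?_
    by_cases hξ : ξ ∈ segmentSet e l
    · have hK : 0 ≤ K := (norm_nonneg _).trans (hθ.bound 0)
      rw [indicator_of_mem hξ, norm_segDensity, norm_mul, Complex.norm_real,
        Real.norm_of_nonneg (by positivity : 0 ≤ (2 * Real.pi * |l|) ^ j * K)]
      rw [mul_assoc _ K, mul_comm K]
      have := abs_sub_le_of_mem_segmentSet hl hξ
      have h3 : ‖segSymbol θ e l ξ‖ ≤ K := hθ.bound _
      gcongr
    · rw [segDensity, hθ.segSymbol_eq_zero hξ, mul_zero, mul_zero, norm_zero]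
      exact norm_nonneg _

theorem IsProfile.hasDerivAt_segDeriv (hθ : IsProfile θ K) {e l : ℝ} (hl : l ≠ 0)
    (G : Lp ℂ 2 (volume : Measure ℝ)) (j : ℕ) (y : ℝ) :
    HasDerivAt (segDeriv θ e l G j) (segDeriv θ e l G (j + 1) y) y := by
  refine hasDerivAt_expIntegral (hθ.integrable_segDensity hl G j)
    (Filter.Eventually.of_forall fun ξ => ?_) (hθ.integrable_segDensity hl G (j + 1)) y
  simp only [segDensity]
  ring

/-- The product of the transform with the symbol is square integrable on a bounded segment, hence
integrable, so the inversion integral applies; demodulation replaces ξ by ξ - e in the exponent. -/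
theorem IsProfile.segOp_ae_eq (hθ : IsProfile θ K) (hf : IsSegmentFamily e l)
    (G : Lp ℂ 2 (volume : Measure ℝ)) (m : ι) :
    segOp θ e l G m =ᵐ[volume] segDeriv θ (e m) (l m) G 0 := by
  have hi := hθ.integrable_segDensity (e := e m) (hf.ne m) G 0
  have h0 : segDensity θ (e m) (l m) G 0 = fun ξ =>
      (𝓕 G : Lp ℂ 2 (volume : Measure ℝ)) ξ * segSymbol θ (e m) (l m) ξ := by
    funext ξ
    rw [segDensity, pow_zero, one_mul]
  rw [h0] at hi
  filter_upwards [fourierMultiplier_ae_eq (hθ.isBoundedSymbol (e m) (l m)) G hi] with y hy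
  rw [segOp, hy, Real.fourierInv_eq', segDeriv, expIntegral, ← integral_const_mul]
  refine integral_congr_ae (Filter.Eventually.of_forall fun ξ => ?_)
  simp only [segDensity, pow_zero, one_mul, smul_eq_mul, RCLike.inner_apply, conj_trivial]
  rw [← mul_assoc, ← Complex.exp_add, mul_comm]
  congr 2
  push_cast
  ring

end

/-! ### Taylor approximation in ℓ² -/

noncomputable section

variable {ι : Type*} {θ : ℝ → ℂ} {K : ℝ} {e l : ι → ℝ}

theorem sum_enorm_rpow_two {s : Finset ι} (v : ι → ℂ) :
    ∑ m ∈ s, ‖v m‖ₑ ^ (2 : ℝ) =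
      ENNReal.ofReal (‖(WithLp.toLp 2 fun m : s => v m : EuclideanSpace ℂ s)‖ ^ 2) := by
  rw [EuclideanSpace.norm_sq_eq, ENNReal.ofReal_sum_of_nonneg fun _ _ => sq_nonneg _,
    ← Finset.sum_coe_sort s]
  simp_rw [enorm_rpow_two]

/-- The Taylor polynomials at the left end approximate the family in `ℓ²`. -/
theorem IsProfile.exists_polynomial_tsum_le (hθ : IsProfile θ K) (hf : IsSegmentFamily e l)
    (G : Lp ℂ 2 (volume : Measure ℝ)) (r : ℕ) {c d D : ℝ} (hD : 0 ≤ D)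
    (h : ∀ y ∈ Icc c d, ∑' m, ‖segDeriv θ (e m) (l m) G r y‖ₑ ^ (2 : ℝ) ≤
      ENNReal.ofReal (D ^ 2)) :
    ∃ P : ι → Polynomial.degreeLT ℂ r, ∀ y ∈ Icc c d,
      ∑' m, ‖segDeriv θ (e m) (l m) G 0 y - (P m : Polynomial ℂ).eval (y : ℂ)‖ₑ ^ (2 : ℝ) ≤
        ENNReal.ofReal ((D * (d - c) ^ r) ^ 2) := by
  let T : ι → Polynomial ℂ := fun m => ∑ j ∈ Finset.range r,
    Polynomial.C (segDeriv θ (e m) (l m) G j c / (j.factorial : ℂ)) *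
      (Polynomial.X - Polynomial.C (c : ℂ)) ^ j
  have hT : ∀ m, T m ∈ Polynomial.degreeLT ℂ r := by
    intro m
    refine Submodule.sum_mem _ fun j hj => ?_
    rw [← Polynomial.smul_eq_C_mul]
    refine Submodule.smul_mem _ _ ?_
    rw [Polynomial.mem_degreeLT, Polynomial.degree_pow, Polynomial.degree_X_sub_C, nsmul_one]
    exact_mod_cast Finset.mem_range.1 hj
  refine ⟨fun m => ⟨T m, hT m⟩, fun y hy => ?_⟩
  -- The Taylor polynomials are chosen before the finite subset, so it suffices to have a uniform
  -- bound over finite subfamilies, viewed in Euclidean space.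
  rw [ENNReal.tsum_eq_iSup_sum]
  refine iSup_le fun s => ?_
  let U : ℕ → ℝ → EuclideanSpace ℂ s := fun j y =>
    WithLp.toLp 2 fun m : s => segDeriv θ (e m) (l m) G j y
  have hU : ∀ j y, HasDerivAt (U j) (U (j + 1) y) y := by
    intro j y
    have h1 : HasDerivAt (fun y => fun m : s => segDeriv θ (e m) (l m) G j y)
        (fun m : s => segDeriv θ (e m) (l m) G (j + 1) y) y :=
      hasDerivAt_pi.2 fun m => hθ.hasDerivAt_segDeriv (hf.ne m) G j y
    exact ((PiLp.continuousLinearEquiv 2 ℝ (fun _ : s => ℂ)).symm.hasFDerivAt.comp_hasDerivAt y h1)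
  have hUr : ∀ y ∈ Icc c d, ‖U r y‖ ≤ D := by
    intro y hy
    have h1 := (ENNReal.sum_le_tsum s).trans (h y hy)
    rw [sum_enorm_rpow_two, ENNReal.ofReal_le_ofReal_iff (sq_nonneg _)] at h1
    exact (sq_le_sq₀ (norm_nonneg _) hD).1 h1
  have key := norm_sub_taylor_le r U hU hUr y hy
  rw [sum_enorm_rpow_two]
  refine ENNReal.ofReal_le_ofReal ?_
  refine pow_le_pow_left₀ (norm_nonneg _) (le_of_eq_of_le ?_ key) 2
  congr 1
  ext m
  simp only [PiLp.sub_apply, U, T]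
  congr 1
  rw [WithLp.ofLp_sum, Finset.sum_apply, Polynomial.eval_finsetSum]
  refine Finset.sum_congr rfl fun j _ => ?_
  simp
  ring

end

/-! ### The oscillatory integral over one segment -/

noncomputable section

/-- The estimate on one segment, by repeated integration by parts for long segments. -/
theorem exists_bound_segment (r : ℕ) {θ : ℝ → ℂ} {K : ℝ} (hθ : IsProfile θ K) :
    ∃ C : ℝ, 0 ≤ C ∧ ∀ Φ : ℕ → ℝ → ℂ, Continuous (Φ 0) →
      (∀ j t, HasDerivAt (Φ (j + 1)) (Φ j t) t) → ∀ e l R : ℝ, l ≠ 0 → 0 < R →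
      (|l| ^ (r + 1) * ‖∫ t in (0 : ℝ)..1, (t : ℂ) ^ r * θ t * Φ 0 (e + l * t)‖) ^ 2 ≤
        C * ((R⁻¹) ^ (2 * r + 1) * (|l| * ∫ t in (0 : ℝ)..1, ‖Φ 0 (e + l * t)‖ ^ 2) +
          (R * (|l| * ∫ t in (0 : ℝ)..1, ‖Φ (r + 1) (e + l * t)‖ ^ 2) +
          R⁻¹ * (|l| * ∫ t in (0 : ℝ)..1, ‖Φ r (e + l * t)‖ ^ 2))) := by
  obtain ⟨K', hK'0, hK'⟩ := exists_bound_integral_pow_mul r θ hθ.smooth (by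
    intro t ht
    by_contra h
    exact absurd (hθ.support h).2 (not_le.2 ht.1))
  have hK0 : 0 ≤ K := (norm_nonneg _).trans (hθ.bound 0)
  refine ⟨K ^ 2 + 6 * K' ^ 2, by positivity, fun Φ hΦ0 hΦ e l R hl hR => ?_⟩
  have hl' : 0 < |l| := abs_pos.2 hl
  have hc : ∀ j, Continuous (Φ j) := by
    rintro (_ | j)
    · exact hΦ0
    · exact continuous_iff_continuousAt.2 fun t => (hΦ j t).continuousAt
  have hlin : Continuous fun t : ℝ => e + l * t := by fun_prop
  have hcs : ∀ j, (∫ t in (0 : ℝ)..1, ‖Φ j (e + l * t)‖) ^ 2 ≤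
      ∫ t in (0 : ℝ)..1, ‖Φ j (e + l * t)‖ ^ 2 := fun j => by
    simpa using sq_integral_le_mul_integral_sq zero_lt_one ((hc j).comp hlin).norm
  have hnn : ∀ j, 0 ≤ ∫ t in (0 : ℝ)..1, ‖Φ j (e + l * t)‖ ^ 2 := fun j =>
    intervalIntegral.integral_nonneg zero_le_one fun t _ => sq_nonneg _
  have h0 := hcs 0
  have h1 := hcs (r + 1)
  have n0 := hnn 0
  have n1 := hnn (r + 1)
  have n2 := hnn r
  set A₀ := ∫ t in (0 : ℝ)..1, ‖Φ 0 (e + l * t)‖ ^ 2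
  set A₁ := ∫ t in (0 : ℝ)..1, ‖Φ (r + 1) (e + l * t)‖ ^ 2
  set A₂ := ∫ t in (0 : ℝ)..1, ‖Φ r (e + l * t)‖ ^ 2
  -- A segment with |l| ≤ 1/R needs no cancellation: bound θ by K and use Cauchy-Schwarz.
  rcases le_total |l| R⁻¹ with hlR | hlR
  · have hb : ‖∫ t in (0 : ℝ)..1, (t : ℂ) ^ r * θ t * Φ 0 (e + l * t)‖ ≤
        K * ∫ t in (0 : ℝ)..1, ‖Φ 0 (e + l * t)‖ := by
      rw [← intervalIntegral.integral_const_mul]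
      apply intervalIntegral.norm_integral_le_of_norm_le zero_le_one
      · refine Filter.Eventually.of_forall fun t ht => ?_
        rw [norm_mul, norm_mul, norm_pow, Complex.norm_real, Real.norm_of_nonneg ht.1.le]
        have : t ^ r ≤ 1 := pow_le_one₀ ht.1.le ht.2
        have := hθ.bound t
        calc t ^ r * ‖θ t‖ * _ ≤ 1 * K * _ := by gcongr
          _ = _ := by rw [one_mul]
      · exact (continuous_const.mul ((hc 0).comp hlin).norm).intervalIntegrable _ _
    calc _ ≤ (|l| ^ (r + 1) * (K * ∫ t in (0 : ℝ)..1, ‖Φ 0 (e + l * t)‖)) ^ 2 := by gcongr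
      _ = K ^ 2 * (|l| ^ (2 * r + 1) * (|l| * (∫ t in (0 : ℝ)..1, ‖Φ 0 (e + l * t)‖) ^ 2)) := by
        ring
      _ ≤ K ^ 2 * ((R⁻¹) ^ (2 * r + 1) * (|l| * A₀)) := by gcongr
      _ ≤ _ := by
        refine mul_le_mul ?_ (le_add_of_nonneg_right ?_) (by positivity) (by positivity)
        · exact le_add_of_nonneg_right (by positivity)
        · positivity
  · have hτ : (R * |l|)⁻¹ ≤ 1 := by
      refine inv_le_one_of_one_le₀ ?_
      calc 1 = R * R⁻¹ := (mul_inv_cancel₀ hR.ne').symm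
        _ ≤ R * |l| := by gcongr
    have hRl : 1 ≤ R * |l| := by
      have := (inv_le_one₀ (by positivity : 0 < R * |l|)).1 hτ
      exact this
    have hlC : (l : ℂ) ≠ 0 := by exact_mod_cast hl
    have hd : ∀ j t, HasDerivAt (fun t => Φ (j + 1) (e + l * t)) (l * Φ j (e + l * t)) t := by
      intro j t
      have h2 : HasDerivAt (fun t : ℝ => e + l * t) l t := by
        simpa using ((hasDerivAt_id t).const_mul l).const_add e
      exact ((hΦ j (e + l * t)).scomp t h2).congr_deriv (by simp)
    -- Division by l^j makes these successive antiderivatives in the variable t; the resulting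
    -- factor |l|^{-(r+1)} cancels the one in front of the integral.
    have hb := hK' (fun j t => ((l : ℂ)⁻¹) ^ j * Φ j (e + l * t)) (by
        simp only [pow_zero, one_mul]
        exact hΦ0.comp hlin) (by
      intro j t
      refine ((hd j t).const_mul _).congr_deriv ?_
      rw [pow_succ]
      field_simp)
    simp only [pow_zero, one_mul, mul_zero, add_zero, norm_mul, norm_pow, norm_inv,
      Complex.norm_real, Real.norm_eq_abs] at hb
    rw [intervalIntegral.integral_const_mul, ← mul_add, inv_pow] at hb
    -- Scale 1/(R|l|) in t is scale 1/R in frequency; it fits inside the segment exactly because the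
    -- segment is long.
    have hs := norm_sq_zero_le_integral (inv_pos.2 (by positivity : 0 < R * |l|)) hτ
      (F := fun t => Φ (r + 1) (e + l * t)) (F' := fun t => l * Φ r (e + l * t))
      (continuous_const.mul ((hc r).comp hlin)) (hd r)
    simp only [mul_zero, add_zero, norm_mul, mul_pow, Complex.norm_real, Real.norm_eq_abs] at hs
    rw [intervalIntegral.integral_const_mul] at hs
    calc _ ≤ (|l| ^ (r + 1) * (K' * ((|l| ^ (r + 1))⁻¹ * (‖Φ (r + 1) e‖ +
          ∫ t in (0 : ℝ)..1, ‖Φ (r + 1) (e + l * t)‖)))) ^ 2 := by gcongr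
      _ = K' ^ 2 * (‖Φ (r + 1) e‖ + ∫ t in (0 : ℝ)..1, ‖Φ (r + 1) (e + l * t)‖) ^ 2 := by
        field_simp
      _ ≤ K' ^ 2 * (2 * (‖Φ (r + 1) e‖ ^ 2 + (∫ t in (0 : ℝ)..1, ‖Φ (r + 1) (e + l * t)‖) ^ 2)) := by
        gcongr
        nlinarith [sq_nonneg (‖Φ (r + 1) e‖ - ∫ t in (0 : ℝ)..1, ‖Φ (r + 1) (e + l * t)‖)]
      _ ≤ K' ^ 2 * (2 * ((2 / (R * |l|)⁻¹ * A₁ + 2 * (R * |l|)⁻¹ * (|l| ^ 2 * A₂)) +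
          R * |l| * A₁)) := by
        gcongr
        exact h1.trans (le_mul_of_one_le_left n1 hRl)
      _ = K' ^ 2 * (6 * (R * (|l| * A₁)) + 4 * (R⁻¹ * (|l| * A₂))) := by
        field_simp
        ring
      _ ≤ 6 * K' ^ 2 * (R * (|l| * A₁) + R⁻¹ * (|l| * A₂)) := by
        have : 0 ≤ K' ^ 2 * (R⁻¹ * (|l| * A₂)) := by positivity
        linarith
      _ ≤ _ := by
        refine mul_le_mul ?_ (le_add_of_nonneg_left ?_) (by positivity) (by positivity)
        · exact le_add_of_nonneg_left (by positivity)
        · positivity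

theorem integral_comp_affine (h : ℝ → ℂ) (e : ℝ) {l : ℝ} (hl : l ≠ 0) :
    ∫ ξ, h ξ = (|l| : ℝ) * ∫ t, h (e + l * t) := by
  have h1 := Measure.integral_comp_mul_left (fun u => h (e + u)) l
  rw [h1, integral_add_left_eq_self, abs_inv, Complex.real_smul]
  push_cast
  rw [← mul_assoc, mul_inv_cancel₀, one_mul]
  exact_mod_cast (abs_pos.2 hl).ne'

theorem ofReal_integral_segment {h : ℝ → ℂ} (hc : Continuous h) (e : ℝ) {l : ℝ} (hl : l ≠ 0) :
    ENNReal.ofReal (|l| * ∫ t in (0 : ℝ)..1, ‖h (e + l * t)‖ ^ 2) =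
      ∫⁻ ξ in segmentSet e l, ‖h ξ‖ₑ ^ (2 : ℝ) := by
  have hm := measurableSet_segmentSet e l
  have h1 : ∫⁻ ξ in segmentSet e l, ‖h ξ‖ₑ ^ (2 : ℝ) =
      ENNReal.ofReal |l| * ∫⁻ t in Icc (0 : ℝ) 1, ‖h (e + l * t)‖ₑ ^ (2 : ℝ) := by
    rw [← lintegral_indicator hm, ← lintegral_indicator measurableSet_Icc,
      ← lintegral_add_left_eq_self _ e]
    have hmap := Real.smul_map_volume_mul_left hl
    conv_lhs => rw [← hmap]
    rw [lintegral_smul_measure, smul_eq_mul]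
    congr 1
    rw [lintegral_map' (by
      refine (Measurable.indicator ?_ hm).aemeasurable.comp_aemeasurable ?_
      · exact (hc.enorm.measurable.pow_const _)
      · fun_prop) (by fun_prop)]
    refine lintegral_congr fun t => ?_
    have : e + l * t ∈ segmentSet e l ↔ t ∈ Icc (0 : ℝ) 1 := by
      rw [segmentSet, mem_ofPred_eq, add_sub_cancel_left, mul_div_cancel_left₀ _ hl]
    simp only [indicator, this]
  rw [h1, ENNReal.ofReal_mul (abs_nonneg _)]
  congr 1
  rw [intervalIntegral.integral_of_le zero_le_one, ← integral_Icc_eq_integral_Ioc,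
    ofReal_integral_eq_lintegral_ofReal]
  · simp_rw [enorm_rpow_two]
  · apply Continuous.integrableOn_Icc
    fun_prop
  · exact Filter.Eventually.of_forall fun t => sq_nonneg _

end

/-! ### Decay of the derivatives away from the support -/

noncomputable section

theorem expIntegral_neg_two_pi (x ξ : ℝ) (g : ℝ → ℂ) :
    expIntegral (-(2 * Real.pi)) x g ξ =
      Complex.exp ((2 * Real.pi * x * ξ : ℝ) * Complex.I) * 𝓕 g ξ := by
  rw [Real.fourier_real_eq_integral_exp_smul, expIntegral, ← integral_const_mul]
  refine integral_congr_ae (Filter.Eventually.of_forall fun y => ?_)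
  simp only [smul_eq_mul]
  rw [← mul_assoc, ← Complex.exp_add, mul_comm]
  congr 2
  push_cast
  ring

theorem Lp.fourier_ae_eq_of_integrable (G : Lp ℂ 2 (volume : Measure ℝ)) (h : Integrable G) :
    (𝓕 G : Lp ℂ 2 (volume : Measure ℝ)) =ᵐ[volume] 𝓕 (G : ℝ → ℂ) := by
  have := fourier_toLp_ae_eq h (Lp.memLp G)
  rwa [Lp.toLp_coeFn] at this

/-- The phase at x is absorbed into Φ, the Fourier transform of G recentred at x. The substitution ξ
= e + l t produces |l|^(r+1), and the remaining phases are unimodular. -/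
theorem IsProfile.norm_segDeriv_eq {θ : ℝ → ℂ} {K : ℝ} (hθ : IsProfile θ K) {e l : ℝ}
    (hl : l ≠ 0) (G : Lp ℂ 2 (volume : Measure ℝ)) (h : Integrable G) (r : ℕ) (x : ℝ) :
    ‖segDeriv θ e l G r x‖ = (2 * Real.pi) ^ r * (|l| ^ (r + 1) *
      ‖∫ t in (0 : ℝ)..1, (t : ℂ) ^ r * θ t * expIntegral (-(2 * Real.pi)) x G (e + l * t)‖) := by
  set Φ := expIntegral (-(2 * Real.pi)) x G
  have h1 : segDeriv θ e l G r x = ∫ ξ, (((2 * Real.pi : ℝ) : ℂ) * Complex.I) ^ r *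
      Complex.exp ((-(2 * Real.pi * x * e) : ℝ) * Complex.I) *
        (((ξ - e : ℝ) : ℂ) ^ r * segSymbol θ e l ξ * Φ ξ) := by
    rw [segDeriv, expIntegral]
    refine integral_congr_ae ?_
    filter_upwards [Lp.fourier_ae_eq_of_integrable G h] with ξ hξ
    have h2 : Complex.exp ((2 * Real.pi * (ξ - e) * x : ℝ) * Complex.I) =
        Complex.exp ((-(2 * Real.pi * x * e) : ℝ) * Complex.I) *
          Complex.exp ((2 * Real.pi * x * ξ : ℝ) * Complex.I) := by
      rw [← Complex.exp_add]
      congr 1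
      push_cast
      ring
    simp only [Φ]
    rw [segDensity, hξ, expIntegral_neg_two_pi, h2, Complex.ofReal_mul (2 * Real.pi) (ξ - e),
      mul_right_comm _ _ Complex.I, mul_pow]
    ring
  rw [h1, integral_const_mul, integral_comp_affine _ e hl]
  have h3 : ∫ t, (((e + l * t - e : ℝ) : ℂ) ^ r * segSymbol θ e l (e + l * t) * Φ (e + l * t)) =
      (l : ℂ) ^ r * ∫ t in (0 : ℝ)..1, (t : ℂ) ^ r * θ t * Φ (e + l * t) := by
    rw [intervalIntegral.integral_of_le zero_le_one, ← integral_Icc_eq_integral_Ioc,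
      setIntegral_eq_integral_of_forall_compl_eq_zero, ← integral_const_mul]
    · refine integral_congr_ae (Filter.Eventually.of_forall fun t => ?_)
      simp only [segSymbol]
      rw [add_sub_cancel_left, mul_div_cancel_left₀ _ hl]
      push_cast
      ring
    · intro t ht
      have : θ t = 0 := by
        by_contra h0
        have := hθ.support h0
        exact ht ⟨this.1, this.2.trans (by norm_num)⟩
      rw [this, mul_zero, zero_mul]
  rw [h3, norm_mul, norm_mul, norm_mul, norm_mul, Complex.norm_exp_ofReal_mul_I, norm_pow, norm_mul,
    norm_pow, Complex.norm_real, Complex.norm_real, Complex.norm_real, Complex.norm_I,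
    Real.norm_of_nonneg Real.two_pi_pos.le, Real.norm_of_nonneg (abs_nonneg _), Real.norm_eq_abs]
  ring

/-- The square function of the derivatives of order `r` at a point that is at distance at least `R`
from the support of the function. -/
theorem IsProfile.exists_bound_tsum_segDeriv {θ : ℝ → ℂ} {K : ℝ} (hθ : IsProfile θ K) (r : ℕ) :
    ∃ C : ℝ, 0 ≤ C ∧ ∀ (ι : Type) [Countable ι] (e l : ι → ℝ), IsSegmentFamily e l →
      ∀ (G : Lp ℂ 2 (volume : Measure ℝ)) (x R M : ℝ), 0 < R →
      (∀ᵐ y, G y ≠ 0 → R ≤ |y - x| ∧ |y - x| ≤ M) →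
      ∑' m, ‖segDeriv θ (e m) (l m) G r x‖ₑ ^ (2 : ℝ) ≤
        ENNReal.ofReal (C * (R⁻¹) ^ (2 * r + 1)) * ∫⁻ y, ‖G y‖ₑ ^ (2 : ℝ) := by
  obtain ⟨C, hC0, hC⟩ := exists_bound_segment r hθ
  -- The factor 3 counts the three terms of the one-segment estimate, each of which sums to
  -- R^{-(2r+1)} times the squared norm.
  refine ⟨((2 * Real.pi) ^ r) ^ 2 * C * 3, by positivity, ?_⟩
  intro ι _ e l hf G x R M hR hG
  -- The outer radius M serves only here, to make G integrable; it does not enter the bound.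
  have hGi : Integrable G := by
    have h1 : IntegrableOn G (Icc (x - M) (x + M)) :=
      ((Lp.memLp G).restrict _).integrable (by norm_num)
    refine (integrable_indicator_iff measurableSet_Icc).2 h1 |>.congr ?_
    filter_upwards [hG] with y hy
    by_cases h0 : G y = 0
    · by_cases hy' : y ∈ Icc (x - M) (x + M)
      · rw [indicator_of_mem hy']
      · rw [indicator_of_notMem hy', h0]
    · have := abs_le.1 (hy h0).2
      rw [indicator_of_mem]
      constructor <;> linarith [this.1, this.2]
  -- Dividing by a power of -2πi(y - x) integrates the transform. On the support of G each division
  -- costs at most 1/R, the factor 2π being discarded.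
  let g : ℕ → ℝ → ℂ := fun j y => (((-(2 * Real.pi) * (y - x) : ℝ) : ℂ) * Complex.I)⁻¹ ^ j * G y
  have hgm : ∀ j, AEStronglyMeasurable (g j) volume := fun j => by
    refine AEStronglyMeasurable.mul ?_ (Lp.aestronglyMeasurable G)
    apply Measurable.aestronglyMeasurable
    fun_prop
  have hgb : ∀ j, ∀ᵐ y, ‖g j y‖ ≤ R⁻¹ ^ j * ‖G y‖ := by
    intro j
    filter_upwards [hG] with y hy
    by_cases h0 : G y = 0
    · simp [g, h0]
    · simp only [g]
      rw [norm_mul, norm_pow, norm_inv, norm_mul, Complex.norm_I, mul_one, Complex.norm_real,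
        Real.norm_eq_abs, abs_mul, abs_neg, abs_of_pos Real.two_pi_pos]
      have h2 : R ≤ 2 * Real.pi * |y - x| := by
        have h3 : 1 ≤ 2 * Real.pi := by linarith [Real.pi_gt_three]
        calc R ≤ |y - x| := (hy h0).1
          _ ≤ _ := le_mul_of_one_le_left (abs_nonneg _) h3
      gcongr
  have hgi : ∀ j, Integrable (g j) := fun j =>
    (hGi.norm.const_mul (R⁻¹ ^ j)).mono' (hgm j) (hgb j)
  have hg2 : ∀ j, MemLp (g j) 2 := fun j => (Lp.memLp G).of_le_mul (hgm j) (hgb j)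
  let Φ : ℕ → ℝ → ℂ := fun j => expIntegral (-(2 * Real.pi)) x (g j)
  have hg0 : g 0 = G := by funext y; simp [g]
  have hΦd : ∀ j t, HasDerivAt (Φ (j + 1)) (Φ j t) t := by
    intro j t
    refine hasDerivAt_expIntegral (hgi (j + 1)) ?_ (hgi j) t
    filter_upwards [hG] with y hy
    by_cases h0 : G y = 0
    · simp [g, h0]
    · have h1 : ((-(2 * Real.pi) * (y - x) : ℝ) : ℂ) * Complex.I ≠ 0 := by
        refine mul_ne_zero ?_ Complex.I_ne_zero
        have h2 : y - x ≠ 0 := abs_pos.1 (hR.trans_le (hy h0).1)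
        have h3 : (-(2 * Real.pi) * (y - x) : ℝ) ≠ 0 :=
          mul_ne_zero (neg_ne_zero.2 Real.two_pi_pos.ne') h2
        exact_mod_cast h3
      simp only [g]
      generalize ((-(2 * Real.pi) * (y - x) : ℝ) : ℂ) * Complex.I = z at h1
      rw [pow_succ, show z * (z⁻¹ ^ j * z⁻¹ * G y) = z * z⁻¹ * (z⁻¹ ^ j * G y) by ring,
        mul_inv_cancel₀ h1, one_mul]
  have hΦn : ∀ j ξ, ‖Φ j ξ‖ = ‖𝓕 (g j) ξ‖ := by
    intro j ξ
    simp only [Φ]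
    rw [expIntegral_neg_two_pi, norm_mul, Complex.norm_exp_ofReal_mul_I, one_mul]
  have hΦc : ∀ j, Continuous (Φ j) := by
    intro j
    have : Φ j = fun ξ => Complex.exp ((2 * Real.pi * x * ξ : ℝ) * Complex.I) * 𝓕 (g j) ξ := by
      funext ξ
      exact expIntegral_neg_two_pi x ξ (g j)
    rw [this]
    have h2 : Continuous (𝓕 (g j)) := VectorFourier.fourierIntegral_continuous (μ := volume)
      Real.continuous_fourierChar (L := innerₗ ℝ) continuous_inner (hgi j)
    fun_prop
  set N := ∫⁻ y, ‖G y‖ₑ ^ (2 : ℝ) with hN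
  have hΦ2 : ∀ j, ∫⁻ ξ, ‖Φ j ξ‖ₑ ^ (2 : ℝ) ≤ ENNReal.ofReal (R⁻¹ ^ (2 * j)) * N := by
    intro j
    have h1 : ∫⁻ ξ, ‖Φ j ξ‖ₑ ^ (2 : ℝ) = ∫⁻ ξ, ‖𝓕 (g j) ξ‖ₑ ^ (2 : ℝ) :=
      lintegral_congr fun ξ => by rw [enorm_rpow_two, enorm_rpow_two, hΦn]
    rw [h1, lintegral_fourierIntegral_enorm_rpow_two (hgi j) (hg2 j), hN,
      ← lintegral_const_mul' _ _ ENNReal.ofReal_ne_top]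
    refine lintegral_mono_ae ?_
    filter_upwards [hgb j] with y hy
    rw [enorm_rpow_two, enorm_rpow_two, ← ENNReal.ofReal_mul (by positivity)]
    refine ENNReal.ofReal_le_ofReal ?_
    calc _ ≤ (R⁻¹ ^ j * ‖G y‖) ^ 2 := by gcongr
      _ = _ := by ring
  let A : ℕ → ι → ℝ := fun j m => |l m| * ∫ t in (0 : ℝ)..1, ‖Φ j (e m + l m * t)‖ ^ 2
  have hA0 : ∀ j m, 0 ≤ A j m := fun j m => mul_nonneg (abs_nonneg _)
    (intervalIntegral.integral_nonneg zero_le_one fun t _ => sq_nonneg _)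
  have hA : ∀ j, ∑' m, ENNReal.ofReal (A j m) ≤ ENNReal.ofReal (R⁻¹ ^ (2 * j)) * N := by
    intro j
    have h1 : ∀ m, ENNReal.ofReal (A j m) =
        ∫⁻ ξ in segmentSet (e m) (l m), ‖Φ j ξ‖ₑ ^ (2 : ℝ) :=
      fun m => ofReal_integral_segment (hΦc j) _ (hf.ne m)
    simp_rw [h1]
    exact (tsum_setLIntegral_le (fun m => measurableSet_segmentSet _ _) hf.disj _).trans (hΦ2 j)
  set c := ((2 * Real.pi) ^ r) ^ 2 * C with hc
  have hc0 : 0 ≤ c := by positivity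
  have hterm : ∀ m, ‖segDeriv θ (e m) (l m) G r x‖ₑ ^ (2 : ℝ) ≤
      ENNReal.ofReal (c * R⁻¹ ^ (2 * r + 1)) * ENNReal.ofReal (A 0 m) +
      (ENNReal.ofReal (c * R) * ENNReal.ofReal (A (r + 1) m) +
        ENNReal.ofReal (c * R⁻¹) * ENNReal.ofReal (A r m)) := by
    intro m
    have a0 := hA0 0 m
    have a1 := hA0 (r + 1) m
    have a2 := hA0 r m
    rw [← ENNReal.ofReal_mul (by positivity), ← ENNReal.ofReal_mul (by positivity),
      ← ENNReal.ofReal_mul (by positivity), ← ENNReal.ofReal_add (by positivity) (by positivity),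
      ← ENNReal.ofReal_add (by positivity) (by positivity), enorm_rpow_two]
    refine ENNReal.ofReal_le_ofReal ?_
    rw [hθ.norm_segDeriv_eq (hf.ne m) G hGi, mul_pow]
    have := hC Φ (hΦc 0) hΦd (e m) (l m) R (hf.ne m) hR
    rw [← hg0]
    calc _ ≤ ((2 * Real.pi) ^ r) ^ 2 * (C * ((R⁻¹) ^ (2 * r + 1) * A 0 m +
          (R * A (r + 1) m + R⁻¹ * A r m))) := by gcongr
      _ = _ := by rw [hc]; ring
  calc _ ≤ _ := ENNReal.tsum_le_tsum hterm
    _ = ENNReal.ofReal (c * R⁻¹ ^ (2 * r + 1)) * ∑' m, ENNReal.ofReal (A 0 m) +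
      (ENNReal.ofReal (c * R) * ∑' m, ENNReal.ofReal (A (r + 1) m) +
        ENNReal.ofReal (c * R⁻¹) * ∑' m, ENNReal.ofReal (A r m)) := by
      rw [ENNReal.tsum_add, ENNReal.tsum_add, ENNReal.tsum_mul_left, ENNReal.tsum_mul_left,
        ENNReal.tsum_mul_left]
    _ ≤ ENNReal.ofReal (c * R⁻¹ ^ (2 * r + 1)) * (ENNReal.ofReal (R⁻¹ ^ (2 * 0)) * N) +
      (ENNReal.ofReal (c * R) * (ENNReal.ofReal (R⁻¹ ^ (2 * (r + 1))) * N) +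
        ENNReal.ofReal (c * R⁻¹) * (ENNReal.ofReal (R⁻¹ ^ (2 * r)) * N)) := by
      gcongr <;> exact hA _
    _ = _ := by
      rw [← mul_assoc, ← mul_assoc, ← mul_assoc, ← ENNReal.ofReal_mul (by positivity),
        ← ENNReal.ofReal_mul (by positivity), ← ENNReal.ofReal_mul (by positivity),
        ← add_mul, ← add_mul, ← ENNReal.ofReal_add (by positivity) (by positivity),
        ← ENNReal.ofReal_add (by positivity) (by positivity)]
      congr 2
      linear_combination (c * R⁻¹ ^ (2 * r + 1)) * mul_inv_cancel₀ hR.ne'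

end

/-! ### Distance from polynomials in L²(ℓ²) -/

noncomputable section

variable {ι : Type*} {θ : ℝ → ℂ} {K : ℝ} {e l : ι → ℝ}

/-- The `L²(μ; ℓ²)` norm of a collection of functions. -/
def l2norm (μ : Measure ℝ) (h : ι → ℝ → ℂ) : ℝ≥0∞ :=
  (∫⁻ t, ∑' m, ‖h m t‖ₑ ^ (2 : ℝ) ∂μ) ^ (1 / 2 : ℝ)

theorem tsum_rpow_two_add_le (a b : ι → ℝ≥0∞) :
    (∑' m, (a m + b m) ^ (2 : ℝ)) ^ (1 / 2 : ℝ) ≤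
      (∑' m, a m ^ (2 : ℝ)) ^ (1 / 2 : ℝ) + (∑' m, b m ^ (2 : ℝ)) ^ (1 / 2 : ℝ) := by
  let _ : MeasurableSpace ι := ⊤
  have := ENNReal.lintegral_Lp_add_le (μ := (Measure.count : Measure ι)) (f := a) (g := b) (p := 2)
    measurable_from_top.aemeasurable measurable_from_top.aemeasurable (by norm_num)
  simpa only [lintegral_count, Pi.add_apply] using this

/-- Minkowski twice: pointwise in ℓ², then in L² for the scalar functions `A u` and `A v`. -/
theorem l2norm_add_le [Countable ι] {μ : Measure ℝ} {u v : ι → ℝ → ℂ}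
    (hu : ∀ m, AEStronglyMeasurable (u m) μ) (hv : ∀ m, AEStronglyMeasurable (v m) μ) :
    l2norm μ (fun m t => u m t + v m t) ≤ l2norm μ u + l2norm μ v := by
  let A : (ι → ℝ → ℂ) → ℝ → ℝ≥0∞ := fun h t => (∑' m, ‖h m t‖ₑ ^ (2 : ℝ)) ^ (1 / 2 : ℝ)
  have hA : ∀ h : ι → ℝ → ℂ, (∀ m, AEStronglyMeasurable (h m) μ) → AEMeasurable (A h) μ :=
    fun h hh => (AEMeasurable.tsum fun m => (hh m).enorm.pow_const _).pow_const _
  have hA2 : ∀ h t, A h t ^ (2 : ℝ) = ∑' m, ‖h m t‖ₑ ^ (2 : ℝ) := by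
    intro h t
    simp only [A]
    rw [← ENNReal.rpow_mul]
    norm_num
  have h1 := ENNReal.lintegral_Lp_add_le (hA u hu) (hA v hv) (p := 2) (by norm_num)
  simp only [Pi.add_apply, hA2] at h1
  refine le_trans ?_ h1
  rw [l2norm]
  refine ENNReal.rpow_le_rpow (lintegral_mono fun t => ?_) (by norm_num)
  rw [← hA2 (fun m t => u m t + v m t) t]
  refine ENNReal.rpow_le_rpow ?_ (by norm_num)
  refine le_trans ?_ (tsum_rpow_two_add_le _ _)
  refine ENNReal.rpow_le_rpow (ENNReal.tsum_le_tsum fun m => ?_) (by norm_num)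
  exact ENNReal.rpow_le_rpow (enorm_add_le _ _) (by norm_num)

/-- The distance in `L²([c, d]; ℓ²)` from the collections of polynomials of degree less than `r`. -/
def polyDist (r : ℕ) (c d : ℝ) (h : ι → ℝ → ℂ) : ℝ≥0∞ :=
  ⨅ P : ι → Polynomial.degreeLT ℂ r,
    l2norm (volume.restrict (Icc c d)) fun m t => h m t - (P m : Polynomial ℂ).eval (t : ℂ)

theorem polyDist_congr [Countable ι] {r : ℕ} {c d : ℝ} {u v : ι → ℝ → ℂ}
    (h : ∀ m, u m =ᵐ[volume] v m) : polyDist r c d u = polyDist r c d v := by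
  rw [polyDist, polyDist]
  refine iInf_congr fun P => ?_
  rw [l2norm, l2norm]
  congr 1
  refine lintegral_congr_ae (ae_restrict_of_ae ?_)
  filter_upwards [ae_all_iff.2 h] with t ht
  simp only [ht]

theorem polyDist_add_le [Countable ι] {r : ℕ} {c d : ℝ} {u v : ι → ℝ → ℂ}
    (hu : ∀ m, AEStronglyMeasurable (u m) volume) (hv : ∀ m, AEStronglyMeasurable (v m) volume) :
    polyDist r c d (fun m t => u m t + v m t) ≤ polyDist r c d u + polyDist r c d v := by
  have hp : ∀ (P : Polynomial ℂ), AEStronglyMeasurable (fun t : ℝ => P.eval (t : ℂ)) volume :=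
    fun P => (P.continuous.comp Complex.continuous_ofReal).aestronglyMeasurable
  rw [polyDist, polyDist, polyDist, ENNReal.iInf_add]
  refine le_iInf fun P => ?_
  rw [ENNReal.add_iInf]
  refine le_iInf fun Q => iInf_le_of_le (P + Q) ?_
  refine le_trans (le_of_eq ?_) (l2norm_add_le (fun m => ((hu m).sub (hp _)).restrict)
    (fun m => ((hv m).sub (hp _)).restrict))
  congr 1
  funext m t
  simp only [Pi.add_apply, Submodule.coe_add, Polynomial.eval_add]
  ring

theorem segOp_aestronglyMeasurable (G : Lp ℂ 2 (volume : Measure ℝ)) (m : ι) :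
    AEStronglyMeasurable (segOp θ e l G m) volume := by
  refine AEStronglyMeasurable.mul ?_ (Lp.aestronglyMeasurable _)
  apply Continuous.aestronglyMeasurable
  fun_prop

theorem IsProfile.segOp_add (hθ : IsProfile θ K) (G H : Lp ℂ 2 (volume : Measure ℝ)) (m : ι) :
    segOp θ e l (G + H) m =ᵐ[volume] fun t => segOp θ e l G m t + segOp θ e l H m t := by
  filter_upwards [Lp.coeFn_add (fourierMultiplier (segSymbol θ (e m) (l m)) G)
    (fourierMultiplier (segSymbol θ (e m) (l m)) H)] with t ht
  rw [segOp, segOp, segOp, fourierMultiplier_add (hθ.isBoundedSymbol _ _), ht, Pi.add_apply, mul_add]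

theorem IsProfile.polyDist_segOp_add_le [Countable ι] (hθ : IsProfile θ K) (r : ℕ) (c d : ℝ)
    (G H : Lp ℂ 2 (volume : Measure ℝ)) :
    polyDist r c d (segOp θ e l (G + H)) ≤
      polyDist r c d (segOp θ e l G) + polyDist r c d (segOp θ e l H) := by
  rw [polyDist_congr fun m => hθ.segOp_add G H m]
  exact polyDist_add_le (segOp_aestronglyMeasurable G) (segOp_aestronglyMeasurable H)

/-- The `L²` norm as an extended real number. -/
def l2 (g : ℝ → ℂ) : ℝ≥0∞ := (∫⁻ y, ‖g y‖ₑ ^ (2 : ℝ)) ^ (1 / 2 : ℝ)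

/-- The zero polynomials suffice. This bound handles the part of the function near the interval and
the remainder at infinity. -/
theorem IsProfile.polyDist_segOp_le_l2 [Countable ι] (hθ : IsProfile θ K)
    (hf : IsSegmentFamily e l) (r : ℕ) (c d : ℝ) (G : Lp ℂ 2 (volume : Measure ℝ)) :
    polyDist r c d (segOp θ e l G) ≤ ENNReal.ofReal K * l2 G := by
  have hK0 : 0 ≤ K := (norm_nonneg _).trans (hθ.bound 0)
  refine iInf_le_of_le 0 ?_
  simp only [Pi.zero_apply, Submodule.coe_zero, Polynomial.eval_zero, sub_zero]
  rw [l2norm, l2]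
  have h1 : ENNReal.ofReal K = ENNReal.ofReal (K ^ 2) ^ (1 / 2 : ℝ) := by
    rw [ENNReal.ofReal_rpow_of_nonneg (sq_nonneg _) (by norm_num), ← Real.sqrt_eq_rpow,
      Real.sqrt_sq hK0]
  rw [h1, ← ENNReal.mul_rpow_of_nonneg _ _ (by norm_num)]
  refine ENNReal.rpow_le_rpow ?_ (by norm_num)
  exact (setLIntegral_le_lintegral _ _).trans (lintegral_tsum_segOp_le hθ hf G)

/-- Taylor expansion gives the power r of the length, and integration of its square over the
interval gives the extra 1/2. -/
theorem IsProfile.polyDist_segOp_le_of_segDeriv [Countable ι] (hθ : IsProfile θ K)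
    (hf : IsSegmentFamily e l) (r : ℕ) {c d : ℝ} (hcd : c < d) (G : Lp ℂ 2 (volume : Measure ℝ))
    {B : ℝ≥0∞} (h : ∀ y ∈ Icc c d, ∑' m, ‖segDeriv θ (e m) (l m) G r y‖ₑ ^ (2 : ℝ) ≤
      B ^ (2 : ℝ)) :
    polyDist r c d (segOp θ e l G) ≤ B * ENNReal.ofReal (d - c) ^ ((r : ℝ) + 1 / 2) := by
  have hL : 0 < d - c := sub_pos.2 hcd
  rcases eq_or_ne B ⊤ with rfl | hB
  · rw [ENNReal.top_mul]
    · exact le_top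
    · exact (ENNReal.rpow_pos (ENNReal.ofReal_pos.2 hL) ENNReal.ofReal_ne_top).ne'
  lift B to ℝ≥0 using hB
  have hBe : (B : ℝ≥0∞) ^ (2 : ℝ) = ENNReal.ofReal ((B : ℝ) ^ 2) := by
    rw [← ENNReal.ofReal_coe_nnreal, ENNReal.ofReal_rpow_of_nonneg B.coe_nonneg (by norm_num),
      Real.rpow_two]
  rw [hBe] at h
  obtain ⟨P, hP⟩ := hθ.exists_polynomial_tsum_le hf G r B.2 h
  rw [polyDist_congr fun m => hθ.segOp_ae_eq hf G m]
  refine iInf_le_of_le P ?_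
  rw [l2norm]
  have h1 : ∫⁻ t in Icc c d, ∑' m, ‖segDeriv θ (e m) (l m) G 0 t -
      (P m : Polynomial ℂ).eval (t : ℂ)‖ₑ ^ (2 : ℝ) ≤
      ENNReal.ofReal (((B : ℝ) * (d - c) ^ r) ^ 2) * ENNReal.ofReal (d - c) := by
    calc _ ≤ ∫⁻ t in Icc c d, ENNReal.ofReal (((B : ℝ) * (d - c) ^ r) ^ 2) :=
          setLIntegral_mono' measurableSet_Icc hP
      _ = _ := by rw [setLIntegral_const, Real.volume_Icc]
  refine (ENNReal.rpow_le_rpow h1 (by norm_num)).trans (le_of_eq ?_)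
  have hB0 : (0 : ℝ) ≤ B := B.2
  rw [← ENNReal.ofReal_mul (by positivity), ENNReal.ofReal_rpow_of_nonneg (by positivity)
    (by norm_num), ENNReal.ofReal_rpow_of_nonneg hL.le (by positivity),
    ← ENNReal.ofReal_coe_nnreal, ← ENNReal.ofReal_mul hB0, Real.mul_rpow (by positivity) hL.le,
    ← Real.sqrt_eq_rpow, Real.sqrt_sq (by positivity), Real.rpow_add hL, Real.rpow_natCast, mul_assoc]

/-- The contribution of a function supported far away from the interval. -/
theorem IsProfile.exists_polyDist_segOp_le_far (hθ : IsProfile θ K) (r : ℕ) :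
    ∃ C : ℝ, 0 ≤ C ∧ ∀ (ι : Type) [Countable ι] (e l : ι → ℝ), IsSegmentFamily e l →
      ∀ (G : Lp ℂ 2 (volume : Measure ℝ)) (c d R M : ℝ), c < d → 0 < R →
      (∀ᵐ y, G y ≠ 0 → ∀ x ∈ Icc c d, R ≤ |y - x| ∧ |y - x| ≤ M) →
      polyDist r c d (segOp θ e l G) ≤
        ENNReal.ofReal (C * ((d - c) / R) ^ ((r : ℝ) + 1 / 2)) * l2 G := by
  obtain ⟨C, hC0, hC⟩ := hθ.exists_bound_tsum_segDeriv r
  refine ⟨√C, Real.sqrt_nonneg _, ?_⟩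
  intro ι _ e l hf G c d R M hcd hR hG
  have hL : 0 < d - c := sub_pos.2 hcd
  have h := hθ.polyDist_segOp_le_of_segDeriv hf r hcd G
    (B := ENNReal.ofReal (√C * R⁻¹ ^ ((r : ℝ) + 1 / 2)) * l2 G) (by
    intro x hx
    refine (hC ι e l hf G x R M hR ?_).trans (le_of_eq ?_)
    · filter_upwards [hG] with y hy h0 using hy h0 x hx
    · rw [ENNReal.mul_rpow_of_nonneg _ _ (by norm_num), l2, ← ENNReal.rpow_mul]
      rw [ENNReal.ofReal_rpow_of_nonneg (by positivity) (by norm_num), Real.rpow_two, mul_pow,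
        Real.sq_sqrt hC0, ← Real.rpow_natCast _ 2, ← Real.rpow_mul (by positivity),
        ← Real.rpow_natCast _ (2 * r + 1), one_div_mul_cancel two_ne_zero, ENNReal.rpow_one]
      congr 4
      push_cast
      ring)
  refine h.trans (le_of_eq ?_)
  rw [ENNReal.ofReal_rpow_of_nonneg hL.le (by positivity), mul_right_comm,
    ← ENNReal.ofReal_mul (by positivity), mul_assoc, ← Real.mul_rpow (by positivity) hL.le,
    div_eq_mul_inv _ R, mul_comm R⁻¹]

end

/-! ### Low frequencies: cut-off polynomials -/

noncomputable section

variable {ι : Type*} {θ : ℝ → ℂ} {K : ℝ} {e l : ι → ℝ}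

/-- This is where the segments must avoid 0: the weight |ξ - e_m|^r can be traded for |ξ|^r, which
annihilates polynomials of degree < r in the limit of large cut-offs. The right-hand side may be
infinite. -/
theorem IsProfile.tsum_segDeriv_le_lintegral [Countable ι] (hθ : IsProfile θ K)
    (hf : IsSegmentFamily e l) (r : ℕ) (G : Lp ℂ 2 (volume : Measure ℝ)) (y : ℝ) :
    ∑' m, ‖segDeriv θ (e m) (l m) G r y‖ₑ ^ (2 : ℝ) ≤
      (ENNReal.ofReal ((4 * Real.pi) ^ r * K) *
        ∫⁻ ξ : ℝ, ‖(ξ : ℂ) ^ r * (𝓕 G : Lp ℂ 2 (volume : Measure ℝ)) ξ‖ₑ) ^ (2 : ℝ) := by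
  have hK0 : 0 ≤ K := (norm_nonneg _).trans (hθ.bound 0)
  have h1 : ∀ m, ‖segDeriv θ (e m) (l m) G r y‖ₑ ≤ ∫⁻ ξ in segmentSet (e m) (l m),
      ENNReal.ofReal ((4 * Real.pi) ^ r * K) *
        ‖(ξ : ℂ) ^ r * (𝓕 G : Lp ℂ 2 (volume : Measure ℝ)) ξ‖ₑ := by
    intro m
    refine (enorm_integral_le_lintegral_enorm _).trans ?_
    rw [← lintegral_indicator (measurableSet_segmentSet _ _)]
    refine lintegral_mono fun ξ => ?_
    rw [← ofReal_norm, norm_mul, Complex.norm_exp_ofReal_mul_I, mul_one, norm_segDensity]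
    by_cases h0 : segSymbol θ (e m) (l m) ξ = 0
    · rw [h0, norm_zero, mul_zero, mul_zero, ENNReal.ofReal_zero]
      exact zero_le
    have hξ : ξ ∈ segmentSet (e m) (l m) := by
      by_contra h
      exact h0 (hθ.segSymbol_eq_zero h)
    -- With t = (ξ - e)/l this reads |ξ - e| ≤ 2|ξ|.
    have h2 := hf.away m _ (hθ.support h0)
    rw [mul_div_cancel₀ _ (hf.ne m), add_sub_cancel] at h2
    rw [indicator_of_mem hξ, ← ofReal_norm, ← ENNReal.ofReal_mul (by positivity)]
    refine ENNReal.ofReal_le_ofReal ?_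
    rw [norm_mul, norm_pow, Complex.norm_real, Real.norm_eq_abs]
    have h3 : ‖segSymbol θ (e m) (l m) ξ‖ ≤ K := hθ.bound _
    calc _ ≤ (2 * Real.pi * (2 * |ξ|)) ^ r * (‖(𝓕 G : Lp ℂ 2 (volume : Measure ℝ)) ξ‖ * K) := by
          gcongr
      _ = (4 * Real.pi * |ξ|) ^ r * (‖(𝓕 G : Lp ℂ 2 (volume : Measure ℝ)) ξ‖ * K) := by
          congr 2
          ring
      _ = _ := by rw [mul_pow]; ring
  have h4 : ∑' m, ‖segDeriv θ (e m) (l m) G r y‖ₑ ≤ ENNReal.ofReal ((4 * Real.pi) ^ r * K) *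
        ∫⁻ ξ : ℝ, ‖(ξ : ℂ) ^ r * (𝓕 G : Lp ℂ 2 (volume : Measure ℝ)) ξ‖ₑ := by
    rw [← lintegral_const_mul' _ _ ENNReal.ofReal_ne_top]
    exact (ENNReal.tsum_le_tsum h1).trans
      (tsum_setLIntegral_le (fun m => measurableSet_segmentSet _ _) hf.disj _)
  simp_rw [ENNReal.rpow_two]
  -- The ℓ² norm is at most the ℓ¹ norm, which disjointness of the segments controls.
  calc _ ≤ ∑' m, ‖segDeriv θ (e m) (l m) G r y‖ₑ * ∑' m, ‖segDeriv θ (e m) (l m) G r y‖ₑ := by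
        refine ENNReal.tsum_le_tsum fun m => ?_
        rw [sq]
        gcongr
        exact ENNReal.le_tsum m
    _ = (∑' m, ‖segDeriv θ (e m) (l m) G r y‖ₑ) ^ 2 := by rw [ENNReal.tsum_mul_right, sq]
    _ ≤ _ := by gcongr

theorem norm_fourier_comp_affine (q : ℝ → ℂ) (x ξ : ℝ) {N : ℝ} (hN : 0 < N) :
    ‖𝓕 (fun y => q ((y - x) / N)) ξ‖ = N * ‖𝓕 q (N * ξ)‖ := by
  have h : 𝓕 (fun y => q ((y - x) / N)) ξ =
      (N : ℂ) * (Complex.exp ((-(2 * Real.pi * x * ξ) : ℝ) * Complex.I) * 𝓕 q (N * ξ)) := by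
    rw [Real.fourier_real_eq_integral_exp_smul, Real.fourier_real_eq_integral_exp_smul q,
      integral_comp_affine _ x hN.ne', abs_of_pos hN, ← integral_const_mul,
      ← integral_const_mul, ← integral_const_mul]
    refine integral_congr_ae (Filter.Eventually.of_forall fun t => ?_)
    simp only [smul_eq_mul]
    rw [add_sub_cancel_left, mul_div_cancel_left₀ _ hN.ne', ← mul_assoc (Complex.exp _),
      ← Complex.exp_add]
    congr 3
    push_cast
    ring
  rw [h, norm_mul, norm_mul, Complex.norm_exp_ofReal_mul_I, one_mul, Complex.norm_real,
    Real.norm_of_nonneg hN.le]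

theorem lintegral_comp_mul_left_pos {φ : ℝ → ℝ≥0∞} (hφ : Measurable φ) {N : ℝ} (hN : 0 < N) :
    ∫⁻ ξ, φ ξ = ENNReal.ofReal N * ∫⁻ ξ, φ (N * ξ) := by
  have hmap := Real.smul_map_volume_mul_left hN.ne'
  conv_lhs => rw [← hmap]
  rw [lintegral_smul_measure, smul_eq_mul, abs_of_pos hN, lintegral_map hφ (by fun_prop)]

/-- The Fourier transform of a polynomial with a smooth cut-off at a large scale concentrates at
the origin. -/
theorem exists_lintegral_fourier_cutoff_le {r : ℕ} (hr : 1 ≤ r) {P : Polynomial ℂ}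
    (hP : P ∈ Polynomial.degreeLT ℂ r) (x : ℝ) {η : ℝ → ℝ} (hη : ContDiff ℝ ∞ η)
    (hηc : HasCompactSupport η) :
    ∃ C : ℝ, 0 ≤ C ∧ ∀ N : ℝ, 1 ≤ N → ∀ G : Lp ℂ 2 (volume : Measure ℝ),
      (G =ᵐ[volume] fun y => P.eval (y : ℂ) * η ((y - x) / N)) →
      ∫⁻ ξ : ℝ, ‖(ξ : ℂ) ^ r * (𝓕 G : Lp ℂ 2 (volume : Measure ℝ)) ξ‖ₑ ≤ ENNReal.ofReal (C / N) := by
  let h : ℕ → SchwartzMap ℝ ℂ := fun n =>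
    HasCompactSupport.toSchwartzMap (f := fun u : ℝ => (u : ℂ) ^ n * (η u : ℂ))
      ((hηc.comp_left (g := fun x : ℝ => (x : ℂ)) (by simp)).mul_left) (by
        have h1 : ContDiff ℝ ∞ fun u : ℝ => (u : ℂ) := Complex.ofRealCLM.contDiff
        exact (h1.pow n).mul (h1.comp hη))
  let p : Polynomial ℂ := P.comp (Polynomial.X + Polynomial.C (x : ℂ))
  have hp : ∀ u : ℂ, P.eval (u + x) = ∑ n ∈ Finset.range r, p.coeff n * u ^ n := by
    intro u
    have h1 : p.eval u = P.eval (u + x) := by simp [p]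
    have h2 : p ∈ Polynomial.degreeLT ℂ r := by
      rw [Polynomial.mem_degreeLT] at hP ⊢
      refine lt_of_le_of_lt ?_ hP
      rcases eq_or_ne P 0 with rfl | hP0
      · simp [p]
      · rw [Polynomial.degree_eq_natDegree hP0]
        refine Polynomial.degree_le_of_natDegree_le ?_
        simp only [p]
        rw [Polynomial.natDegree_comp, Polynomial.natDegree_X_add_C, mul_one]
    rw [← h1]
    refine Polynomial.eval_eq_sum_range' ?_ u
    rw [Polynomial.mem_degreeLT] at h2
    rcases eq_or_ne p 0 with h0 | h0
    · rw [h0, Polynomial.natDegree_zero]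
      exact hr
    · exact (Polynomial.natDegree_lt_iff_degree_lt h0).2 h2
  let I : ℕ → ℝ := fun n => ∫ u, ‖u‖ ^ r * ‖(𝓕 (h n)) u‖
  have hI0 : ∀ n, 0 ≤ I n := fun n => integral_nonneg fun u => by positivity
  refine ⟨∑ n ∈ Finset.range r, ‖p.coeff n‖ * I n,
    Finset.sum_nonneg fun n _ => mul_nonneg (norm_nonneg _) (hI0 n), ?_⟩
  intro N hN G hG
  have hN0 : 0 < N := zero_lt_one.trans_le hN
  -- In the variable u = (y - x)/N the cut-off polynomial is a combination of the fixed functions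
  -- u^n η(u), n < r, with coefficients growing like N^n.
  let q : SchwartzMap ℝ ℂ := ∑ n ∈ Finset.range r, (p.coeff n * (N : ℂ) ^ n) • h n
  have hq : ∀ y : ℝ, P.eval (y : ℂ) * η ((y - x) / N) = q ((y - x) / N) := by
    intro y
    have hNC : (N : ℂ) ≠ 0 := by exact_mod_cast hN0.ne'
    have h1 : (y : ℂ) = (N : ℂ) * (((y - x) / N : ℝ) : ℂ) + x := by
      push_cast
      field_simp
      ring
    rw [h1, hp, Finset.sum_mul]
    simp only [q, sum_apply, smul_apply, smul_eq_mul]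
    refine Finset.sum_congr rfl fun n _ => ?_
    have : h n ((y - x) / N) = (((y - x) / N : ℝ) : ℂ) ^ n * (η ((y - x) / N) : ℂ) := rfl
    rw [this]
    ring
  have hqi : Integrable fun y => q ((y - x) / N) :=
    (q.integrable.comp_div hN0.ne').comp_sub_right x
  have hG' : G =ᵐ[volume] fun y => q ((y - x) / N) := by
    filter_upwards [hG] with y hy
    rw [hy, hq]
  have hGi : Integrable G := hqi.congr hG'.symm
  have hF : ∀ᵐ ξ : ℝ, ‖(ξ : ℂ) ^ r * (𝓕 G : Lp ℂ 2 (volume : Measure ℝ)) ξ‖ₑ =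
      ENNReal.ofReal (N⁻¹ ^ r) * (ENNReal.ofReal N *
        ENNReal.ofReal (‖N * ξ‖ ^ r * ‖(𝓕 q) (N * ξ)‖)) := by
    filter_upwards [Lp.fourier_ae_eq_of_integrable G hGi] with ξ hξ
    rw [hξ, Real.fourier_congr_ae hG', ← ofReal_norm, norm_mul, norm_fourier_comp_affine _ _ _ hN0,
      ← ENNReal.ofReal_mul hN0.le, ← ENNReal.ofReal_mul (by positivity), norm_pow,
      Complex.norm_real, norm_mul, mul_pow, Real.norm_of_nonneg hN0.le, SchwartzMap.fourier_coe]
    congr 1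
    rw [inv_pow]
    field_simp
  have hqm : Measurable fun u : ℝ => ENNReal.ofReal (‖u‖ ^ r * ‖(𝓕 q) u‖) := by
    apply Continuous.measurable
    have := (𝓕 q).continuous
    exact ENNReal.continuous_ofReal.comp (by fun_prop)
  have hint : ∀ n, Integrable fun u : ℝ => ‖u‖ ^ r * ‖(𝓕 (h n)) u‖ := fun n =>
    (𝓕 (h n)).integrable_pow_mul volume r
  have hq2 : ∫⁻ u : ℝ, ENNReal.ofReal (‖u‖ ^ r * ‖(𝓕 q) u‖) ≤
      ENNReal.ofReal (∑ n ∈ Finset.range r, ‖p.coeff n‖ * N ^ n * I n) := by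
    have h1 : ∑ n ∈ Finset.range r, ‖p.coeff n‖ * N ^ n * I n =
        ∫ u : ℝ, ∑ n ∈ Finset.range r, ‖p.coeff n‖ * N ^ n * (‖u‖ ^ r * ‖(𝓕 (h n)) u‖) := by
      rw [integral_finsetSum _ fun n _ => (hint n).const_mul _]
      simp_rw [integral_const_mul]
      rfl
    rw [h1, ofReal_integral_eq_lintegral_ofReal
      (integrable_finsetSum _ fun n _ => (hint n).const_mul _)
      (Filter.Eventually.of_forall fun u => Finset.sum_nonneg fun n _ => by positivity)]
    refine lintegral_mono fun u => ENNReal.ofReal_le_ofReal ?_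
    have h2 : (𝓕 q) u = ∑ n ∈ Finset.range r, (p.coeff n * (N : ℂ) ^ n) * (𝓕 (h n)) u := by
      simp only [q, FourierTransform.fourier_sum, FourierTransform.fourier_smul,
        sum_apply, smul_apply, smul_eq_mul]
    rw [h2]
    calc _ ≤ ‖u‖ ^ r * ∑ n ∈ Finset.range r, ‖(p.coeff n * (N : ℂ) ^ n) * (𝓕 (h n)) u‖ := by
          gcongr
          exact norm_sum_le _ _
      _ = _ := by
          rw [Finset.mul_sum]
          refine Finset.sum_congr rfl fun n _ => ?_
          rw [norm_mul, norm_mul, norm_pow, Complex.norm_real, Real.norm_of_nonneg hN0.le]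
          ring
  rw [lintegral_congr_ae hF, lintegral_const_mul' _ _ ENNReal.ofReal_ne_top,
    lintegral_const_mul' _ _ ENNReal.ofReal_ne_top, ← lintegral_comp_mul_left_pos hqm hN0]
  refine (mul_le_mul_right hq2 _).trans ?_
  rw [← ENNReal.ofReal_mul (by positivity)]
  refine ENNReal.ofReal_le_ofReal ?_
  rw [Finset.mul_sum, Finset.sum_div]
  refine Finset.sum_le_sum fun n hn => ?_
  -- Rescaling ξ^r gains N^{-r} and the coefficient loses at most N^{r-1}.
  have h3 : N⁻¹ ^ r * N ^ n ≤ N⁻¹ := by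
    have h4 : N ^ (n + 1) ≤ N ^ r := pow_le_pow_right₀ hN (Finset.mem_range.1 hn)
    rw [inv_pow, inv_mul_le_iff₀ (by positivity), ← div_eq_mul_inv, le_div_iff₀ hN0]
    rwa [pow_succ] at h4
  calc _ = (N⁻¹ ^ r * N ^ n) * (‖p.coeff n‖ * I n) := by ring
    _ ≤ N⁻¹ * (‖p.coeff n‖ * I n) :=
      mul_le_mul_of_nonneg_right h3 (mul_nonneg (norm_nonneg _) (hI0 n))
    _ = _ := by ring

end

/-! ### Growth of polynomials on dilated intervals -/

noncomputable section

/-- On polynomials of degree less than `i` the coefficients are controlled by the `L²` norm on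
`[-1, 1]`. -/
theorem exists_norm_sq_degreeLTEquiv_le (i : ℕ) : ∃ A : ℝ, 0 ≤ A ∧
    ∀ p : Polynomial.degreeLT ℂ i, ‖Polynomial.degreeLTEquiv ℂ i p‖ ^ 2 ≤
      A * ∫ t in (-1 : ℝ)..1, ‖(p : Polynomial ℂ).eval (t : ℂ)‖ ^ 2 := by
  let F : (Fin i → ℂ) → ℝ → ℂ := fun c t => ∑ j, c j * (t : ℂ) ^ (j : ℕ)
  have hF : ∀ (p : Polynomial.degreeLT ℂ i) (t : ℝ),
      (p : Polynomial ℂ).eval (t : ℂ) = F (Polynomial.degreeLTEquiv ℂ i p) t := fun p t =>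
    Polynomial.eval_eq_sum_degreeLTEquiv p.2 _
  have hFc : Continuous (Function.uncurry F) := by
    simp only [F, Function.uncurry_def]
    fun_prop
  suffices h : ∃ A : ℝ, 0 ≤ A ∧ ∀ c : Fin i → ℂ, ‖c‖ ^ 2 ≤ A * ∫ t in (-1 : ℝ)..1, ‖F c t‖ ^ 2 by
    obtain ⟨A, hA0, hA⟩ := h
    refine ⟨A, hA0, fun p => ?_⟩
    simp_rw [hF]
    exact hA _
  -- A continuous function, homogeneous of degree two and positive off 0: its minimum on the unit
  -- sphere gives the constant.
  let Ψ : (Fin i → ℂ) → ℝ := fun c => ∫ t in (-1 : ℝ)..1, ‖F c t‖ ^ 2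
  have hΨc : Continuous Ψ :=
    intervalIntegral.continuous_parametric_intervalIntegral_of_continuous'
      (f := fun c t => ‖F c t‖ ^ 2) (by
        have := hFc.norm.pow 2
        exact this) _ _
  have hΨ0 : ∀ c, 0 ≤ Ψ c := fun c =>
    intervalIntegral.integral_nonneg (by norm_num) fun t _ => sq_nonneg _
  have hpos : ∀ c, c ≠ 0 → 0 < Ψ c := by
    intro c hc
    refine intervalIntegral.integral_pos (by norm_num) ?_ (fun t _ => sq_nonneg _) ?_
    · have : Continuous (F c) := hFc.comp (by fun_prop : Continuous fun t : ℝ => (c, t))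
      exact (this.norm.pow 2).continuousOn
    · by_contra! h
      obtain ⟨p, rfl⟩ := (Polynomial.degreeLTEquiv ℂ i).surjective c
      refine hc ?_
      have hp : (p : Polynomial ℂ) = 0 := by
        refine Polynomial.eq_zero_of_infinite_isRoot _ ?_
        refine ((Icc_infinite (by norm_num : (-1 : ℝ) < 1)).image
          (Complex.ofReal_injective.injOn)).mono ?_
        rintro _ ⟨t, ht, rfl⟩
        have h1 := h t ht
        rw [← hF] at h1
        have h2 : ‖(p : Polynomial ℂ).eval (t : ℂ)‖ ^ 2 = 0 := le_antisymm h1 (sq_nonneg _)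
        exact norm_eq_zero.1 (pow_eq_zero_iff two_ne_zero |>.1 h2)
      have : p = 0 := Subtype.ext hp
      rw [this, map_zero]
  -- The sphere is empty when i = 0.
  rcases (Metric.sphere (0 : Fin i → ℂ) 1).eq_empty_or_nonempty with hS | hS
  · refine ⟨0, le_rfl, fun c => ?_⟩
    have : c = 0 := by
      by_contra hc
      have : (‖c‖⁻¹ : ℝ) • c ∈ Metric.sphere (0 : Fin i → ℂ) 1 := by
        rw [mem_sphere_zero_iff_norm, norm_smul, norm_inv, norm_norm,
          inv_mul_cancel₀ (norm_ne_zero_iff.2 hc)]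
      rw [hS] at this
      exact this
    simp [this]
  · obtain ⟨c₀, hc₀, hmin⟩ := (isCompact_sphere (0 : Fin i → ℂ) 1).exists_isMinOn hS
      hΨc.continuousOn
    have hc₀0 : c₀ ≠ 0 := by
      rintro rfl
      simp at hc₀
    have hm := hpos c₀ hc₀0
    refine ⟨(Ψ c₀)⁻¹, by positivity, fun c => ?_⟩
    rw [inv_mul_eq_div, le_div_iff₀ hm]
    rcases eq_or_ne c 0 with rfl | hc
    · simpa using hΨ0 0
    have hn : 0 < ‖c‖ := norm_pos_iff.2 hc
    have h1 : Ψ c₀ ≤ Ψ ((‖c‖⁻¹ : ℝ) • c) := hmin (by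
      rw [mem_sphere_zero_iff_norm, norm_smul, norm_inv, norm_norm, inv_mul_cancel₀ hn.ne'])
    have h2 : Ψ ((‖c‖⁻¹ : ℝ) • c) = (‖c‖ ^ 2)⁻¹ * Ψ c := by
      simp only [Ψ]
      rw [← intervalIntegral.integral_const_mul]
      refine intervalIntegral.integral_congr fun t _ => ?_
      have : F ((‖c‖⁻¹ : ℝ) • c) t = ((‖c‖⁻¹ : ℝ) : ℂ) * F c t := by
        simp only [F, Pi.smul_apply, Complex.real_smul, Finset.mul_sum, mul_assoc]
      simp only [this, norm_mul, Complex.norm_real, mul_pow, norm_inv, norm_norm, inv_pow]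
    rw [h2, inv_mul_eq_div, le_div_iff₀ (by positivity)] at h1
    rw [mul_comm]
    exact h1

theorem lintegral_Icc_comp_affine {φ : ℝ → ℝ≥0∞} (hφ : Measurable φ) (x : ℝ) {ρ : ℝ} (hρ : 0 < ρ)
    (ν : ℝ) : ∫⁻ y in Icc (x - ν * ρ) (x + ν * ρ), φ y =
      ENNReal.ofReal ρ * ∫⁻ t in Icc (-ν) ν, φ (x + ρ * t) := by
  rw [← lintegral_indicator measurableSet_Icc, ← lintegral_indicator measurableSet_Icc,
    ← lintegral_add_left_eq_self _ x, lintegral_comp_mul_left_pos _ hρ]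
  · congr 1
    refine lintegral_congr fun t => ?_
    have : x + ρ * t ∈ Icc (x - ν * ρ) (x + ν * ρ) ↔ t ∈ Icc (-ν) ν := by
      rw [mem_Icc, mem_Icc]
      constructor <;> rintro ⟨h1, h2⟩ <;> constructor <;> nlinarith
    simp only [indicator, this]
  · exact (hφ.indicator measurableSet_Icc).comp (by fun_prop)

/-- Growth of the `L²` norm of polynomials under dilation of the interval. -/
theorem exists_lintegral_polynomial_dilation_le (i : ℕ) : ∃ C : ℝ, 0 ≤ C ∧
    ∀ p ∈ Polynomial.degreeLT ℂ i, ∀ x ρ ν : ℝ, 0 < ρ → 1 ≤ ν →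
      ∫⁻ y in Icc (x - ν * ρ) (x + ν * ρ), ‖p.eval (y : ℂ)‖ₑ ^ (2 : ℝ) ≤
        ENNReal.ofReal (C * ν ^ (2 * (i : ℝ) - 1)) *
          ∫⁻ y in Icc (x - ρ) (x + ρ), ‖p.eval (y : ℂ)‖ₑ ^ (2 : ℝ) := by
  obtain ⟨A, hA0, hA⟩ := exists_norm_sq_degreeLTEquiv_le i
  refine ⟨2 * (i : ℝ) ^ 2 * A, by positivity, fun p hp x ρ ν hρ hν => ?_⟩
  have hν0 : 0 < ν := zero_lt_one.trans_le hν
  have hm : Measurable fun y : ℝ => ‖p.eval (y : ℂ)‖ₑ ^ (2 : ℝ) :=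
    ((p.continuous.comp Complex.continuous_ofReal).enorm.measurable).pow_const _
  let q : Polynomial ℂ := p.comp (Polynomial.C (ρ : ℂ) * Polynomial.X + Polynomial.C (x : ℂ))
  have hq : q ∈ Polynomial.degreeLT ℂ i := by
    rw [Polynomial.mem_degreeLT] at hp ⊢
    refine lt_of_le_of_lt ?_ hp
    rcases eq_or_ne p 0 with rfl | hp0
    · simp [q]
    · rw [Polynomial.degree_eq_natDegree hp0]
      refine Polynomial.degree_le_of_natDegree_le ?_
      simp only [q]
      rw [Polynomial.natDegree_comp]
      exact mul_le_of_le_one_right zero_le (Polynomial.natDegree_linear_le)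
  have hqe : ∀ t : ℝ, p.eval ((x + ρ * t : ℝ) : ℂ) = q.eval (t : ℂ) := by
    intro t
    simp only [q, Polynomial.eval_comp, Polynomial.eval_add, Polynomial.eval_mul, Polynomial.eval_C,
      Polynomial.eval_X]
    push_cast
    rw [add_comm]
  have h1 := lintegral_Icc_comp_affine hm x hρ 1
  rw [one_mul] at h1
  rw [lintegral_Icc_comp_affine hm x hρ ν, h1, mul_left_comm]
  gcongr
  simp_rw [hqe]
  set c := Polynomial.degreeLTEquiv ℂ i ⟨q, hq⟩ with hc
  have h2 : ‖c‖ ^ 2 ≤ A * ∫ t in (-1 : ℝ)..1, ‖q.eval (t : ℂ)‖ ^ 2 := hA ⟨q, hq⟩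
  have hqc : Continuous fun t : ℝ => ‖q.eval (t : ℂ)‖ ^ 2 :=
    (q.continuous.comp Complex.continuous_ofReal).norm.pow 2
  have h3 : ENNReal.ofReal (∫ t in (-1 : ℝ)..1, ‖q.eval (t : ℂ)‖ ^ 2) =
      ∫⁻ t in Icc (-1 : ℝ) 1, ‖q.eval (t : ℂ)‖ₑ ^ (2 : ℝ) := by
    rw [intervalIntegral.integral_of_le (by norm_num), ← integral_Icc_eq_integral_Ioc,
      ofReal_integral_eq_lintegral_ofReal hqc.integrableOn_Icc
        (Filter.Eventually.of_forall fun t => sq_nonneg _)]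
    simp_rw [enorm_rpow_two]
  have h4 : ∀ t ∈ Icc (-ν) ν, ‖q.eval (t : ℂ)‖ₑ ^ (2 : ℝ) ≤
      ENNReal.ofReal ((i : ℝ) ^ 2 * (ν ^ (i - 1)) ^ 2 * ‖c‖ ^ 2) := by
    intro t ht
    rw [enorm_rpow_two]
    refine ENNReal.ofReal_le_ofReal ?_
    rw [Polynomial.eval_eq_sum_degreeLTEquiv hq, ← mul_pow, ← mul_pow]
    refine pow_le_pow_left₀ (norm_nonneg _) ?_ 2
    refine (norm_sum_le _ _).trans ?_
    calc _ ≤ ∑ j : Fin i, ‖c‖ * ν ^ (i - 1) := by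
          refine Finset.sum_le_sum fun j _ => ?_
          rw [norm_mul, norm_pow, Complex.norm_real, Real.norm_eq_abs]
          have h5 : |t| ≤ ν := abs_le.2 ht
          have h6 : ‖c j‖ ≤ ‖c‖ := norm_le_pi_norm c j
          have h7 : |t| ^ (j : ℕ) ≤ ν ^ (i - 1) :=
            (pow_le_pow_left₀ (abs_nonneg _) h5 _).trans (pow_le_pow_right₀ hν (by omega))
          exact mul_le_mul h6 h7 (by positivity) (norm_nonneg _)
      _ = _ := by
        rw [Finset.sum_const, Finset.card_univ, Fintype.card_fin, nsmul_eq_mul]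
        ring
  -- For i = 0 the truncated exponent i - 1 differs from the real one, but the polynomial is 0.
  -- Otherwise ν^(2i-1) is the squared degree growth times the length.
  rcases Nat.eq_zero_or_pos i with hi | hi
  · have : q = 0 := by
      rw [hi, Polynomial.mem_degreeLT, Nat.cast_zero] at hq
      exact Polynomial.degree_eq_bot.1 (Nat.WithBot.lt_zero_iff.1 hq)
    simp [this]
  calc _ ≤ ∫⁻ t in Icc (-ν) ν, ENNReal.ofReal ((i : ℝ) ^ 2 * (ν ^ (i - 1)) ^ 2 * ‖c‖ ^ 2) :=
        setLIntegral_mono' measurableSet_Icc h4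
    _ = ENNReal.ofReal ((i : ℝ) ^ 2 * (ν ^ (i - 1)) ^ 2 * ‖c‖ ^ 2 * (2 * ν)) := by
        rw [setLIntegral_const, Real.volume_Icc, ← ENNReal.ofReal_mul (by positivity)]
        congr 2
        ring
    _ ≤ ENNReal.ofReal (2 * (i : ℝ) ^ 2 * A * ν ^ (2 * (i : ℝ) - 1) *
          ∫ t in (-1 : ℝ)..1, ‖q.eval (t : ℂ)‖ ^ 2) := by
        refine ENNReal.ofReal_le_ofReal ?_
        have h8 : ν ^ (2 * (i : ℝ) - 1) = (ν ^ (i - 1)) ^ 2 * ν := by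
          rw [← pow_mul, ← pow_succ, ← Real.rpow_natCast]
          congr 1
          have : ((i - 1 : ℕ) : ℝ) = i - 1 := by
            rw [Nat.cast_sub hi, Nat.cast_one]
          push_cast
          rw [this]
          ring
        rw [h8]
        calc _ = (i : ℝ) ^ 2 * (ν ^ (i - 1)) ^ 2 * (2 * ν) * ‖c‖ ^ 2 := by ring
          _ ≤ (i : ℝ) ^ 2 * (ν ^ (i - 1)) ^ 2 * (2 * ν) *
              (A * ∫ t in (-1 : ℝ)..1, ‖q.eval (t : ℂ)‖ ^ 2) := by gcongr
          _ = _ := by ring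
    _ = _ := by rw [ENNReal.ofReal_mul (by positivity), h3]

end

/-! ### Dyadic dilates and annuli -/

noncomputable section

theorem eLpNorm_two_eq (g : ℝ → ℂ) (μ : Measure ℝ) :
    eLpNorm g 2 μ = (∫⁻ y, ‖g y‖ₑ ^ (2 : ℝ) ∂μ) ^ (1 / 2 : ℝ) := by
  rw [eLpNorm_eq_lintegral_rpow_enorm_toReal (by norm_num) (by norm_num)]
  simp

/-- The interval of length `2 ^ k * L` with the centre `x`. -/
def dyadicDilate (x L : ℝ) (k : ℕ) : Set ℝ := Icc (x - 2 ^ k * (L / 2)) (x + 2 ^ k * (L / 2))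

theorem measurableSet_dyadicDilate (x L : ℝ) (k : ℕ) : MeasurableSet (dyadicDilate x L k) :=
  measurableSet_Icc

theorem mem_dyadicDilate {x L y : ℝ} {k : ℕ} :
    y ∈ dyadicDilate x L k ↔ |y - x| ≤ 2 ^ k * (L / 2) := by
  rw [dyadicDilate, mem_Icc, abs_le]
  constructor <;> rintro ⟨h1, h2⟩ <;> constructor <;> linarith

theorem dyadicDilate_mono {x L : ℝ} (hL : 0 < L) {j k : ℕ} (hjk : j ≤ k) :
    dyadicDilate x L j ⊆ dyadicDilate x L k := by
  intro y hy
  rw [mem_dyadicDilate] at hy ⊢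
  refine hy.trans ?_
  have : (2 : ℝ) ^ j ≤ 2 ^ k := pow_le_pow_right₀ (by norm_num) hjk
  gcongr

/-- If a function is approximated by polynomials of degree less than `i` at the rate `s` on all
dyadic dilates of an interval, then the polynomial of the first interval serves for all of them at
the rate `μ ≥ max s (i - 1)`, up to a factor that is linear in the number of the dilate. -/
theorem exists_eLpNorm_sub_polynomial_le (i : ℕ) {s μ : ℝ} (hs : s ≤ μ) (hi : (i : ℝ) - 1 ≤ μ) :
    ∃ C : ℝ, 0 ≤ C ∧ ∀ (f : ℝ → ℂ), AEStronglyMeasurable f volume → ∀ (x L : ℝ), 0 < L →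
      ∀ (B : ℝ≥0∞) (p : ℕ → Polynomial ℂ), (∀ k, p k ∈ Polynomial.degreeLT ℂ i) →
      (∀ k, eLpNorm (fun y => f y - (p k).eval (y : ℂ)) 2
        (volume.restrict (dyadicDilate x L k)) ≤ B * ENNReal.ofReal ((2 ^ k * L) ^ (s + 1 / 2))) →
      ∀ k : ℕ, eLpNorm (fun y => f y - (p 0).eval (y : ℂ)) 2
        (volume.restrict (dyadicDilate x L k)) ≤
          B * ENNReal.ofReal (C * (k + 1) * ((2 : ℝ) ^ k) ^ (μ + 1 / 2) * L ^ (s + 1 / 2)) := by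
  obtain ⟨C, hC0, hC⟩ := exists_lintegral_polynomial_dilation_le i
  set C' := √C * (1 + 2 ^ (s + 1 / 2)) with hC'
  have hC'0 : 0 ≤ C' := by positivity
  refine ⟨1 + C', by positivity, ?_⟩
  intro f hf x L hL B p hp h k
  set Lσ := L ^ (s + 1 / 2) with hLσ
  have hLσ0 : 0 ≤ Lσ := by positivity
  have hpm : ∀ (P : Polynomial ℂ) (ν : Measure ℝ),
      AEStronglyMeasurable (fun y : ℝ => P.eval (y : ℂ)) ν :=
    fun P ν => (P.continuous.comp Complex.continuous_ofReal).aestronglyMeasurable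
  have hpow : ∀ j : ℕ, ((2 : ℝ) ^ j) ^ (s + 1 / 2) ≤ ((2 : ℝ) ^ j) ^ (μ + 1 / 2) := fun j =>
    Real.rpow_le_rpow_of_exponent_le (one_le_pow₀ (by norm_num)) (by linarith)
  -- The square root of ν^(2i-1) is ν^(i-1/2), and i - 1/2 ≤ μ + 1/2.
  have hdil : ∀ j ≤ k, ∀ P ∈ Polynomial.degreeLT ℂ i,
      eLpNorm (fun y : ℝ => P.eval (y : ℂ)) 2 (volume.restrict (dyadicDilate x L k)) ≤
        ENNReal.ofReal (√C * ((2 : ℝ) ^ (k - j)) ^ (μ + 1 / 2)) *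
          eLpNorm (fun y : ℝ => P.eval (y : ℂ)) 2 (volume.restrict (dyadicDilate x L j)) := by
    intro j hj P hP
    have h1 := hC P hP x (2 ^ j * (L / 2)) (2 ^ (k - j)) (by positivity)
      (one_le_pow₀ (by norm_num))
    rw [← mul_assoc, ← pow_add, Nat.sub_add_cancel hj] at h1
    rw [eLpNorm_two_eq, eLpNorm_two_eq]
    refine (ENNReal.rpow_le_rpow h1 (by norm_num : (0 : ℝ) ≤ 1 / 2)).trans ?_
    rw [ENNReal.mul_rpow_of_nonneg _ _ (by norm_num),
      ENNReal.ofReal_rpow_of_nonneg (by positivity) (by norm_num),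
      Real.mul_rpow hC0 (by positivity), ← Real.sqrt_eq_rpow, ← Real.rpow_mul (by positivity)]
    refine mul_le_mul_left (ENNReal.ofReal_le_ofReal ?_) _
    refine mul_le_mul_of_nonneg_left ?_ (Real.sqrt_nonneg _)
    exact Real.rpow_le_rpow_of_exponent_le (one_le_pow₀ (by norm_num)) (by linarith)
  -- On the j-th dilate the two errors bound p_{j+1} - p_j, whence 1 + 2^(s+1/2); dilation then
  -- carries the bound to the k-th. The result does not depend on j, so the k steps of the
  -- telescoping sum give the linear factor.
  have hstep : ∀ j ∈ Finset.range k, eLpNorm (fun y : ℝ => (p (j + 1) - p j).eval (y : ℂ)) 2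
      (volume.restrict (dyadicDilate x L k)) ≤
        B * ENNReal.ofReal (C' * ((2 : ℝ) ^ k) ^ (μ + 1 / 2) * Lσ) := by
    intro j hj
    have hjk := Finset.mem_range.1 hj
    refine (hdil j hjk.le _ (Submodule.sub_mem _ (hp _) (hp _))).trans ?_
    have h1 : (fun y : ℝ => (p (j + 1) - p j).eval (y : ℂ)) =
        (fun y : ℝ => f y - (p j).eval (y : ℂ)) - fun y : ℝ => f y - (p (j + 1)).eval (y : ℂ) := by
      funext y
      simp only [Polynomial.eval_sub, Pi.sub_apply]
      ring
    have h2 : eLpNorm (fun y : ℝ => (p (j + 1) - p j).eval (y : ℂ)) 2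
        (volume.restrict (dyadicDilate x L j)) ≤
          B * ENNReal.ofReal ((1 + 2 ^ (s + 1 / 2)) * ((2 : ℝ) ^ j) ^ (μ + 1 / 2) * Lσ) := by
      rw [h1]
      refine (eLpNorm_sub_le (hf.restrict.sub (hpm _ _)) (hf.restrict.sub (hpm _ _))
        (by norm_num)).trans ?_
      have h3 := (eLpNorm_mono_measure (fun y : ℝ => f y - (p (j + 1)).eval (y : ℂ))
        (Measure.restrict_mono (dyadicDilate_mono (x := x) hL (Nat.le_succ j)) le_rfl)
        (p := 2)).trans (h (j + 1))
      refine (add_le_add (h j) h3).trans ?_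
      rw [← mul_add, ← ENNReal.ofReal_add (by positivity) (by positivity)]
      refine mul_le_mul_right (ENNReal.ofReal_le_ofReal ?_) _
      rw [pow_succ, Real.mul_rpow (by positivity) hL.le, Real.mul_rpow (by positivity) hL.le,
        Real.mul_rpow (by positivity) (by norm_num), ← hLσ]
      calc _ = (1 + 2 ^ (s + 1 / 2)) * ((2 : ℝ) ^ j) ^ (s + 1 / 2) * Lσ := by ring
        _ ≤ _ := by
          have := hpow j
          gcongr
    refine (mul_le_mul_right h2 _).trans (le_of_eq ?_)
    rw [mul_left_comm, ← ENNReal.ofReal_mul (by positivity)]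
    congr 2
    have h4 : ((2 : ℝ) ^ k) ^ (μ + 1 / 2) =
        ((2 : ℝ) ^ (k - j)) ^ (μ + 1 / 2) * ((2 : ℝ) ^ j) ^ (μ + 1 / 2) := by
      rw [← Real.mul_rpow (by positivity) (by positivity), ← pow_add, Nat.sub_add_cancel hjk.le]
    rw [h4, hC']
    ring
  have hdec : (fun y : ℝ => f y - (p 0).eval (y : ℂ)) =
      (fun y : ℝ => f y - (p k).eval (y : ℂ)) +
        ∑ j ∈ Finset.range k, fun y : ℝ => (p (j + 1) - p j).eval (y : ℂ) := by
    funext y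
    simp only [Pi.add_apply, Finset.sum_apply, Polynomial.eval_sub]
    rw [Finset.sum_range_sub (fun j => (p j).eval (y : ℂ))]
    ring
  rw [hdec]
  refine (eLpNorm_add_le (hf.restrict.sub (hpm _ _))
    (Finset.aestronglyMeasurable_sum _ fun j _ => hpm _ _) (by norm_num)).trans ?_
  refine (add_le_add (h k) ((eLpNorm_sum_le (fun j _ => hpm _ _) (by norm_num)).trans
    (Finset.sum_le_sum hstep))).trans ?_
  rw [Finset.sum_const, Finset.card_range, nsmul_eq_mul, mul_left_comm, ← mul_add,
    ← ENNReal.ofReal_natCast, ← ENNReal.ofReal_mul (by positivity),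
    ← ENNReal.ofReal_add (by positivity) (by positivity)]
  refine mul_le_mul_right (ENNReal.ofReal_le_ofReal ?_) _
  rw [Real.mul_rpow (by positivity) hL.le, ← hLσ]
  have h5 := hpow k
  have h6 : (0 : ℝ) ≤ k := k.cast_nonneg
  have h7 : 0 ≤ ((2 : ℝ) ^ k) ^ (μ + 1 / 2) * Lσ := by positivity
  calc _ ≤ ((2 : ℝ) ^ k) ^ (μ + 1 / 2) * Lσ + k * (C' * ((2 : ℝ) ^ k) ^ (μ + 1 / 2) * Lσ) := by
        gcongr
    _ = (1 + k * C') * (((2 : ℝ) ^ k) ^ (μ + 1 / 2) * Lσ) := by ring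
    _ ≤ ((1 + C') * (k + 1)) * (((2 : ℝ) ^ k) ^ (μ + 1 / 2) * Lσ) := by
        refine mul_le_mul_of_nonneg_right ?_ h7
        nlinarith
    _ = _ := by ring

/-- The restriction of a square integrable function to a measurable set. -/
def cutLp {S : Set ℝ} (hS : MeasurableSet S) (F : Lp ℂ 2 (volume : Measure ℝ)) :
    Lp ℂ 2 (volume : Measure ℝ) :=
  ((Lp.memLp F).indicator hS).toLp (S.indicator F)

theorem coeFn_cutLp {S : Set ℝ} (hS : MeasurableSet S) (F : Lp ℂ 2 (volume : Measure ℝ)) :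
    cutLp hS F =ᵐ[volume] S.indicator F :=
  MemLp.coeFn_toLp _

theorem l2_cutLp {S : Set ℝ} (hS : MeasurableSet S) (F : Lp ℂ 2 (volume : Measure ℝ)) :
    l2 (cutLp hS F) = eLpNorm F 2 (volume.restrict S) := by
  rw [← eLpNorm_indicator_eq_eLpNorm_restrict hS, ← eLpNorm_congr_ae (coeFn_cutLp hS F),
    eLpNorm_two_eq, l2]

theorem cutLp_add_cutLp_diff {S T : Set ℝ} (hS : MeasurableSet S) (hT : MeasurableSet T)
    (hST : S ⊆ T) (F : Lp ℂ 2 (volume : Measure ℝ)) :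
    cutLp hT F = cutLp hS F + cutLp (hT.diff hS) F := by
  refine Lp.ext ?_
  filter_upwards [coeFn_cutLp hS F, coeFn_cutLp hT F, coeFn_cutLp (hT.diff hS) F,
    Lp.coeFn_add (cutLp hS F) (cutLp (hT.diff hS) F)] with y h1 h2 h3 h4
  rw [h4, Pi.add_apply, h1, h2, h3]
  by_cases hyS : y ∈ S
  · simp [hyS, hST hyS]
  · by_cases hyT : y ∈ T <;> simp [hyS, hyT]

/-- Summation of the contributions of dyadic annuli. -/
theorem IsProfile.exists_polyDist_segOp_cutLp_le {θ : ℝ → ℂ} {K : ℝ} (hθ : IsProfile θ K) (r : ℕ) :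
    ∃ C : ℝ, 0 ≤ C ∧ ∀ (ι : Type) [Countable ι] (e l : ι → ℝ), IsSegmentFamily e l →
      ∀ (F : Lp ℂ 2 (volume : Measure ℝ)) (x L : ℝ), 0 < L → ∀ n : ℕ,
      polyDist r (x - L / 2) (x + L / 2)
          (segOp θ e l (cutLp (measurableSet_dyadicDilate x L (n + 1)) F)) ≤
        ∑ k ∈ Finset.range (n + 1), ENNReal.ofReal (C * (((2 : ℝ) ^ k)⁻¹) ^ ((r : ℝ) + 1 / 2)) *
          eLpNorm F 2 (volume.restrict (dyadicDilate x L (k + 1))) := by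
  obtain ⟨C, hC0, hC⟩ := hθ.exists_polyDist_segOp_le_far r
  have hK0 : 0 ≤ K := (norm_nonneg _).trans (hθ.bound 0)
  -- K serves the innermost piece and the other summand the annuli.
  refine ⟨K + C * 4 ^ ((r : ℝ) + 1 / 2), by positivity, ?_⟩
  intro ι _ e l hf F x L hL n
  induction n with
  | zero =>
    refine (hθ.polyDist_segOp_le_l2 hf r _ _ _).trans ?_
    rw [l2_cutLp, Finset.sum_range_one, pow_zero, inv_one, Real.one_rpow, mul_one]
    refine mul_le_mul_left (ENNReal.ofReal_le_ofReal ?_) _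
    exact le_add_of_nonneg_right (by positivity)
  | succ n ih =>
    rw [cutLp_add_cutLp_diff (measurableSet_dyadicDilate x L (n + 1))
      (measurableSet_dyadicDilate x L (n + 1 + 1)) (dyadicDilate_mono hL (Nat.le_succ _)),
      Finset.sum_range_succ]
    refine (hθ.polyDist_segOp_add_le r _ _ _ _).trans (add_le_add ih ?_)
    set D := dyadicDilate x L (n + 1 + 1) \ dyadicDilate x L (n + 1)
    have hD : MeasurableSet D :=
      (measurableSet_dyadicDilate x L (n + 1 + 1)).diff (measurableSet_dyadicDilate x L (n + 1))
    have h2 : (2 : ℝ) ≤ 2 ^ (n + 1) := by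
      rw [pow_succ]
      have : (1 : ℝ) ≤ 2 ^ n := one_le_pow₀ (by norm_num)
      linarith
    -- A point of the annulus is farther than 2^(n+1) L/2 from the centre and a point of the
    -- interval at most L/2, so their distance is at least 2^(n+1) L/4, as 2 ≤ 2^(n+1).
    have h1 := hC ι e l hf (cutLp hD F) (x - L / 2) (x + L / 2) (2 ^ (n + 1) * L / 4)
      (2 ^ (n + 1 + 1) * L) (by linarith) (by positivity) (by
      filter_upwards [coeFn_cutLp hD F] with y hy h0 z hz
      have hyD : y ∈ D := by
        by_contra h
        rw [hy, indicator_of_notMem h] at h0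
        exact h0 rfl
      have ha := mem_dyadicDilate.1 hyD.1
      have hb : 2 ^ (n + 1) * (L / 2) < |y - x| := by
        have := hyD.2
        rwa [mem_dyadicDilate, not_le] at this
      have hc : |z - x| ≤ L / 2 := abs_le.2 ⟨by linarith [hz.1], by linarith [hz.2]⟩
      have t1 : |y - x| ≤ |y - z| + |z - x| := abs_sub_le y z x
      have t2 : |y - z| ≤ |y - x| + |z - x| := by
        rw [abs_sub_comm z x]
        exact abs_sub_le y x z
      rw [pow_succ _ (n + 1)] at *
      constructor <;> nlinarith)
    refine h1.trans ?_
    rw [l2_cutLp]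
    refine mul_le_mul' (ENNReal.ofReal_le_ofReal ?_)
      (eLpNorm_mono_measure _ (Measure.restrict_mono sdiff_subset le_rfl))
    have h3 : (x + L / 2 - (x - L / 2)) / (2 ^ (n + 1) * L / 4) = 4 * ((2 : ℝ) ^ (n + 1))⁻¹ := by
      field_simp
      ring
    rw [h3, Real.mul_rpow (by norm_num) (by positivity), ← mul_assoc]
    gcongr
    exact le_add_of_nonneg_left hK0

end

/-! ### Assembly of the three pieces on one interval -/

noncomputable section

theorem l2_congr {u v : ℝ → ℂ} (h : u =ᵐ[volume] v) : l2 u = l2 v := by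
  rw [l2, l2]
  congr 1
  refine lintegral_congr_ae ?_
  filter_upwards [h] with y hy
  rw [hy]

/-- The cut-off error of a square integrable function tends to `0`. -/
theorem tendsto_l2_mul_one_sub_cutoff (f : Lp ℂ 2 (volume : Measure ℝ)) (η : ContDiffBump (0 : ℝ))
    (x : ℝ) {N : ℕ → ℝ} (hN : Filter.Tendsto N Filter.atTop Filter.atTop) :
    Filter.Tendsto (fun k => l2 fun y => f y * (1 - (η ((y - x) / N k) : ℂ))) Filter.atTop
      (nhds 0) := by
  have h0 : (0 : ℝ≥0∞) = (∫⁻ _ : ℝ, 0) ^ (1 / 2 : ℝ) := by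
    rw [lintegral_zero, ENNReal.zero_rpow_of_pos (by norm_num)]
  have hn : ∀ u : ℝ, ‖1 - (η u : ℂ)‖ ≤ 1 := by
    intro u
    have h1 : (1 : ℂ) - η u = ((1 - η u : ℝ) : ℂ) := by push_cast; rfl
    have h2 := η.nonneg (x := u)
    have h3 := η.le_one (x := u)
    rw [h1, Complex.norm_real, Real.norm_of_nonneg (by linarith)]
    linarith
  rw [h0]
  refine (ENNReal.continuous_rpow_const.tendsto _).comp ?_
  refine tendsto_lintegral_of_dominated_convergence' (fun y => ‖f y‖ₑ ^ (2 : ℝ)) ?_ ?_ ?_ ?_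
  · intro k
    refine AEMeasurable.pow_const (AEStronglyMeasurable.enorm ?_) _
    refine (Lp.aestronglyMeasurable f).mul ?_
    have := η.continuous
    apply Continuous.aestronglyMeasurable
    fun_prop
  · intro k
    refine Filter.Eventually.of_forall fun y => ?_
    beta_reduce
    rw [enorm_rpow_two, enorm_rpow_two]
    refine ENNReal.ofReal_le_ofReal ?_
    gcongr
    rw [norm_mul]
    exact mul_le_of_le_one_right (norm_nonneg _) (hn _)
  · rw [lintegral_enorm_rpow_two_eq]
    exact ENNReal.rpow_ne_top_of_nonneg (by norm_num) enorm_ne_top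
  · refine Filter.Eventually.of_forall fun y => ?_
    refine tendsto_const_nhds.congr' ?_
    have h1 : Filter.Tendsto (fun k => (y - x) / N k) Filter.atTop (nhds 0) :=
      tendsto_const_nhds.div_atTop hN
    filter_upwards [h1.eventually (Metric.closedBall_mem_nhds 0 η.rIn_pos)] with k hk
    rw [η.one_of_mem_closedBall hk]
    simp

/-- The function is split into dyadic annuli around the interval, a polynomial with a smooth cut-off
at a large scale, and a small remainder. -/
theorem IsProfile.exists_polyDist_segOp_le_of_rate {θ : ℝ → ℂ} {K : ℝ} (hθ : IsProfile θ K)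
    (i r : ℕ) (s : ℝ) (hr : 1 ≤ r) (hrs : max s ((i : ℝ) - 1) < (r : ℝ)) :
    ∃ C : ℝ, 0 ≤ C ∧ ∀ (ι : Type) [Countable ι] (e l : ι → ℝ), IsSegmentFamily e l →
      ∀ (f : Lp ℂ 2 (volume : Measure ℝ)) (x L : ℝ), 0 < L →
      ∀ (B : ℝ≥0∞) (p : ℕ → Polynomial ℂ), (∀ k, p k ∈ Polynomial.degreeLT ℂ i) →
      (∀ k, eLpNorm (fun y => f y - (p k).eval (y : ℂ)) 2
        (volume.restrict (dyadicDilate x L k)) ≤ B * ENNReal.ofReal ((2 ^ k * L) ^ (s + 1 / 2))) →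
      polyDist r (x - L / 2) (x + L / 2) (segOp θ e l f) ≤
        B * ENNReal.ofReal (C * L ^ (s + 1 / 2)) := by
  set μ := max s ((i : ℝ) - 1) with hμ
  obtain ⟨C₁, hC₁0, hC₁⟩ := exists_eLpNorm_sub_polynomial_le i (le_max_left s ((i : ℝ) - 1))
    (le_max_right s ((i : ℝ) - 1))
  rw [← hμ] at hC₁
  obtain ⟨C₂, hC₂0, hC₂⟩ := hθ.exists_polyDist_segOp_cutLp_le r
  -- The ratio of growth to decay over consecutive annuli; it is below 1 because μ < r. The weight k
  -- + 2 is the linear factor of the dilate k + 1.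
  let q : ℝ := 2 ^ (μ - r)
  have hq0 : 0 ≤ q := by positivity
  have hq1 : q < 1 := Real.rpow_lt_one_of_one_lt_of_neg (by norm_num) (by linarith)
  have hsum : Summable fun k : ℕ => ((k : ℝ) + 2) * q ^ k := by
    have h1 := summable_pow_mul_geometric_of_norm_lt_one 1
      (by rwa [Real.norm_of_nonneg hq0] : ‖q‖ < 1)
    have h2 := summable_geometric_of_lt_one hq0 hq1
    refine (h1.add (h2.mul_left 2)).congr fun k => ?_
    rw [pow_one]
    ring
  set S := ∑' k : ℕ, ((k : ℝ) + 2) * q ^ k with hS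
  have hS0 : 0 ≤ S := tsum_nonneg fun k => by positivity
  refine ⟨C₂ * C₁ * 2 ^ (μ + 1 / 2) * S, by positivity, ?_⟩
  intro ι _ e l hf f x L hL B p hp h
  -- From i - 1 < r for integers; hence p_0 has degree < r.
  have hir : i ≤ r := by
    have h1 := (le_max_right s ((i : ℝ) - 1)).trans_lt hrs
    have h2 : (i : ℝ) < (r + 1 : ℕ) := by push_cast; linarith
    exact Nat.lt_succ_iff.1 (by exact_mod_cast h2)
  let η : ContDiffBump (0 : ℝ) := ⟨1, 2, by norm_num, by norm_num⟩
  have hηc : Continuous fun u : ℝ => (η u : ℂ) := Complex.continuous_ofReal.comp η.continuous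
  have hη1 : ∀ u, ‖(η u : ℂ)‖ ≤ 1 := fun u => by
    rw [Complex.norm_real, Real.norm_of_nonneg η.nonneg]
    exact η.le_one
  -- The half-length of the k-th dilate, so the cut-off, which vanishes beyond twice this scale,
  -- lives in the next dilate.
  let N : ℕ → ℝ := fun k => 2 ^ k * (L / 2)
  have hN0 : ∀ k, 0 < N k := fun k => by positivity
  have hNt : Filter.Tendsto N Filter.atTop Filter.atTop :=
    (tendsto_pow_atTop_atTop_of_one_lt (by norm_num : (1 : ℝ) < 2)).atTop_mul_const (by positivity)
  have hηN : ∀ k, Continuous fun y : ℝ => (η ((y - x) / N k) : ℂ) := fun k => by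
    have := η.continuous
    fun_prop
  have hsupp : ∀ k y, y ∉ dyadicDilate x L (k + 1) → η ((y - x) / N k) = 0 := by
    intro k y hy
    rw [mem_dyadicDilate, not_le] at hy
    refine η.zero_of_le_dist ?_
    rw [Real.dist_eq, sub_zero, abs_div, abs_of_pos (hN0 k)]
    change 2 ≤ _
    rw [le_div_iff₀ (hN0 k)]
    refine le_trans (le_of_eq ?_) hy.le
    simp only [N, pow_succ]
    ring
  have hp0c : Continuous fun y : ℝ => (p 0).eval (y : ℂ) :=
    (p 0).continuous.comp Complex.continuous_ofReal
  have hPm : ∀ k, MemLp (fun y : ℝ => (p 0).eval (y : ℂ) * η ((y - x) / N k)) 2 := by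
    intro k
    refine Continuous.memLp_of_hasCompactSupport (hp0c.mul (hηN k)) ?_
    refine HasCompactSupport.intro (K := dyadicDilate x L (k + 1)) isCompact_Icc fun y hy => ?_
    rw [hsupp k y hy, Complex.ofReal_zero, mul_zero]
  have hfm : ∀ k, MemLp (fun y : ℝ => f y * η ((y - x) / N k)) 2 := fun k =>
    (Lp.memLp f).of_le_mul (c := 1) ((Lp.aestronglyMeasurable f).mul (hηN k).aestronglyMeasurable)
      (Filter.Eventually.of_forall fun y => by
        rw [norm_mul, mul_comm]
        exact mul_le_mul_of_nonneg_right (hη1 _) (norm_nonneg _))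
  have hFm : ∀ k, MemLp (fun y : ℝ => (f y - (p 0).eval (y : ℂ)) * η ((y - x) / N k)) 2 := by
    intro k
    refine ((hfm k).sub (hPm k)).congr_norm ?_ (Filter.Eventually.of_forall fun y => ?_)
    · exact ((Lp.aestronglyMeasurable f).sub hp0c.aestronglyMeasurable).mul
        (hηN k).aestronglyMeasurable
    · rw [Pi.sub_apply, sub_mul]
  have hRm : ∀ k, MemLp (fun y : ℝ => f y * (1 - (η ((y - x) / N k) : ℂ))) 2 := by
    intro k
    refine ((Lp.memLp f).sub (hfm k)).congr_norm ?_ (Filter.Eventually.of_forall fun y => ?_)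
    · exact (Lp.aestronglyMeasurable f).mul (continuous_const.sub (hηN k)).aestronglyMeasurable
    · rw [Pi.sub_apply, mul_sub, mul_one]
  let F : ℕ → Lp ℂ 2 (volume : Measure ℝ) := fun k => (hFm k).toLp
  let P : ℕ → Lp ℂ 2 (volume : Measure ℝ) := fun k => (hPm k).toLp
  let R : ℕ → Lp ℂ 2 (volume : Measure ℝ) := fun k => (hRm k).toLp
  have hdec : ∀ k, f = F k + (P k + R k) := by
    intro k
    refine Lp.ext ?_
    filter_upwards [(hFm k).coeFn_toLp, (hPm k).coeFn_toLp, (hRm k).coeFn_toLp,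
      Lp.coeFn_add (F k) (P k + R k), Lp.coeFn_add (P k) (R k)] with y h1 h2 h3 h4 h5
    rw [h4, Pi.add_apply, h5, Pi.add_apply, h1, h2, h3]
    ring
  have hcut : ∀ k, cutLp (measurableSet_dyadicDilate x L (k + 1)) (F k) = F k := by
    intro k
    refine Lp.ext ?_
    filter_upwards [coeFn_cutLp (measurableSet_dyadicDilate x L (k + 1)) (F k),
      (hFm k).coeFn_toLp] with y h1 h2
    rw [h1]
    by_cases hy : y ∈ dyadicDilate x L (k + 1)
    · rw [indicator_of_mem hy]
    · rw [indicator_of_notMem hy, h2, hsupp k y hy, Complex.ofReal_zero, mul_zero]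
  -- The bound is uniform in n: the partial sums are dominated by S.
  have hmain : ∀ n, polyDist r (x - L / 2) (x + L / 2) (segOp θ e l (F n)) ≤
      B * ENNReal.ofReal (C₂ * C₁ * 2 ^ (μ + 1 / 2) * S * L ^ (s + 1 / 2)) := by
    intro n
    have h1 := hC₂ ι e l hf (F n) x L hL n
    rw [hcut] at h1
    refine h1.trans ?_
    have h2 : ∀ k : ℕ, eLpNorm (F n) 2 (volume.restrict (dyadicDilate x L (k + 1))) ≤
        B * ENNReal.ofReal (C₁ * ((k : ℝ) + 2) * ((2 : ℝ) ^ (k + 1)) ^ (μ + 1 / 2) *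
          L ^ (s + 1 / 2)) := by
      intro k
      refine (eLpNorm_mono_ae (g := fun y => f y - (p 0).eval (y : ℂ)) ?_).trans
        ((hC₁ f (Lp.aestronglyMeasurable f) x L hL B p hp h (k + 1)).trans (le_of_eq ?_))
      · refine ae_restrict_of_ae ?_
        filter_upwards [(hFm n).coeFn_toLp] with y hy
        rw [hy, norm_mul]
        exact mul_le_of_le_one_right (norm_nonneg _) (hη1 _)
      · push_cast
        rw [add_assoc (k : ℝ) 1 1, one_add_one_eq_two]
    have h3 : ∀ k ∈ Finset.range (n + 1),
        ENNReal.ofReal (C₂ * (((2 : ℝ) ^ k)⁻¹) ^ ((r : ℝ) + 1 / 2)) *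
          eLpNorm (F n) 2 (volume.restrict (dyadicDilate x L (k + 1))) ≤
        B * ENNReal.ofReal (C₂ * C₁ * 2 ^ (μ + 1 / 2) * L ^ (s + 1 / 2) *
          (((k : ℝ) + 2) * q ^ k)) := by
      intro k _
      refine (mul_le_mul_right (h2 k) _).trans (le_of_eq ?_)
      rw [mul_left_comm, ← ENNReal.ofReal_mul (by positivity)]
      congr 2
      have h4 : (((2 : ℝ) ^ k)⁻¹) ^ ((r : ℝ) + 1 / 2) * ((2 : ℝ) ^ (k + 1)) ^ (μ + 1 / 2) =
          2 ^ (μ + 1 / 2) * q ^ k := by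
        simp only [q]
        rw [pow_succ, Real.mul_rpow (by positivity) (by norm_num), ← Real.rpow_natCast 2 k,
          ← Real.rpow_neg (by norm_num), ← Real.rpow_mul (by norm_num), ← Real.rpow_mul (by norm_num),
          ← Real.rpow_natCast _ k, ← Real.rpow_mul (by norm_num), ← mul_assoc,
          ← Real.rpow_add (by norm_num), mul_comm]
        congr 2
        ring
      linear_combination (C₂ * C₁ * ((k : ℝ) + 2) * L ^ (s + 1 / 2)) * h4
    refine (Finset.sum_le_sum h3).trans ?_
    rw [← Finset.mul_sum, ← ENNReal.ofReal_sum_of_nonneg fun k _ => by positivity, ← Finset.mul_sum]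
    refine mul_le_mul_right (ENNReal.ofReal_le_ofReal ?_) _
    rw [mul_right_comm _ S]
    refine mul_le_mul_of_nonneg_left ?_ (by positivity)
    exact hsum.sum_le_tsum _ fun k _ => by positivity
  obtain ⟨C₃, hC₃0, hC₃⟩ := exists_lintegral_fourier_cutoff_le hr
    (Polynomial.degreeLT_mono hir (hp 0)) x η.contDiff η.hasCompactSupport
  have hP : ∀ᶠ k in Filter.atTop, polyDist r (x - L / 2) (x + L / 2) (segOp θ e l (P k)) ≤
      ENNReal.ofReal ((4 * Real.pi) ^ r * K) * ENNReal.ofReal (C₃ / N k) *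
        ENNReal.ofReal L ^ ((r : ℝ) + 1 / 2) := by
    filter_upwards [hNt.eventually_ge_atTop 1] with k hk
    have h1 := hθ.polyDist_segOp_le_of_segDeriv hf r (c := x - L / 2) (d := x + L / 2)
      (by linarith) (P k) (fun y _ => hθ.tsum_segDeriv_le_lintegral hf r (P k) y)
    rw [show x + L / 2 - (x - L / 2) = L by ring] at h1
    refine h1.trans ?_
    gcongr
    exact hC₃ (N k) hk (P k) (hPm k).coeFn_toLp
  have hR : ∀ k, polyDist r (x - L / 2) (x + L / 2) (segOp θ e l (R k)) ≤
      ENNReal.ofReal K * l2 fun y => f y * (1 - (η ((y - x) / N k) : ℂ)) := by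
    intro k
    refine (hθ.polyDist_segOp_le_l2 hf r _ _ _).trans (le_of_eq ?_)
    rw [l2_congr (hRm k).coeFn_toLp]
  have hlim : Filter.Tendsto (fun k => B * ENNReal.ofReal (C₂ * C₁ * 2 ^ (μ + 1 / 2) * S *
      L ^ (s + 1 / 2)) + (ENNReal.ofReal ((4 * Real.pi) ^ r * K) * ENNReal.ofReal (C₃ / N k) *
        ENNReal.ofReal L ^ ((r : ℝ) + 1 / 2) +
      ENNReal.ofReal K * l2 fun y => f y * (1 - (η ((y - x) / N k) : ℂ)))) Filter.atTop
      (nhds (B * ENNReal.ofReal (C₂ * C₁ * 2 ^ (μ + 1 / 2) * S * L ^ (s + 1 / 2)) +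
        (ENNReal.ofReal ((4 * Real.pi) ^ r * K) * ENNReal.ofReal 0 *
          ENNReal.ofReal L ^ ((r : ℝ) + 1 / 2) + ENNReal.ofReal K * 0))) := by
    refine tendsto_const_nhds.add (Filter.Tendsto.add ?_ ?_)
    · refine ENNReal.Tendsto.mul_const (ENNReal.Tendsto.const_mul ?_ (Or.inr ENNReal.ofReal_ne_top))
        (Or.inr (ENNReal.rpow_ne_top_of_nonneg (by positivity) ENNReal.ofReal_ne_top))
      exact ENNReal.tendsto_ofReal (tendsto_const_nhds.div_atTop hNt)
    · exact ENNReal.Tendsto.const_mul (tendsto_l2_mul_one_sub_cutoff f η x hNt)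
        (Or.inr ENNReal.ofReal_ne_top)
  rw [ENNReal.ofReal_zero, mul_zero, zero_mul, mul_zero, add_zero, add_zero] at hlim
  -- The left-hand side does not depend on the cut-off scale, while the last two pieces vanish in
  -- the limit.
  refine ge_of_tendsto hlim ?_
  filter_upwards [hP] with k hk
  conv_lhs => rw [hdec k]
  refine (hθ.polyDist_segOp_add_le r _ _ _ _).trans (add_le_add (hmain k) ?_)
  exact (hθ.polyDist_segOp_add_le r _ _ _ _).trans (add_le_add hk (hR k))

end

/-! ### From the estimate on intervals to the maximal functions -/

noncomputable section

theorem rpow_mul_inv_mul_rpow_half {a : ℝ≥0∞} (h0 : a ≠ 0) (ht : a ≠ ⊤) (s : ℝ) (X : ℝ≥0∞) :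
    a ^ (-s) * (a⁻¹ * X) ^ (1 / 2 : ℝ) = a ^ (-(s + 1 / 2)) * X ^ (1 / 2 : ℝ) := by
  rw [ENNReal.mul_rpow_of_nonneg _ _ (by norm_num), ENNReal.inv_rpow, ← ENNReal.rpow_neg,
    ← mul_assoc, ← ENNReal.rpow_add _ _ h0 ht]
  congr 2
  ring

theorem iInf_campanato_eq {ι : Type*} (r : ℕ) (s : ℝ) (h : ι → ℝ → ℂ) {c d : ℝ} (hcd : c < d) :
    (⨅ P : ι → Polynomial.degreeLT ℂ r, ENNReal.ofReal (d - c) ^ (-s) *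
        ((ENNReal.ofReal (d - c))⁻¹ * ∫⁻ t in Icc c d,
          (∑' m, ‖h m t - (P m : Polynomial ℂ).eval (t : ℂ)‖ₑ ^ (2 : ℝ)) ^ ((2 : ℝ) / 2)) ^
            (1 / 2 : ℝ)) =
      ENNReal.ofReal (d - c) ^ (-(s + 1 / 2)) * polyDist r c d h := by
  have h0 : ENNReal.ofReal (d - c) ≠ 0 := (ENNReal.ofReal_pos.2 (sub_pos.2 hcd)).ne'
  have ht : ENNReal.ofReal (d - c) ≠ ⊤ := ENNReal.ofReal_ne_top
  simp_rw [rpow_mul_inv_mul_rpow_half h0 ht, div_self (two_ne_zero (α := ℝ)), ENNReal.rpow_one]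
  rw [polyDist, ENNReal.mul_iInf_of_ne]
  · rfl
  · exact (ENNReal.rpow_pos h0.bot_lt ht).ne'
  · exact ENNReal.rpow_ne_top_of_ne_zero h0 ht

/-- A strict majorant B is needed because no minimising polynomial is assumed to exist. -/
theorem exists_polynomial_of_campanatoMaxScalar_lt {i : ℕ} {s : ℝ} {f : ℝ → ℂ} {x : ℝ} {B : ℝ≥0∞}
    (hB : campanatoMaxScalar i 2 s f x < B) {c d : ℝ} (hcd : c < d) (hx : x ∈ Icc c d) :
    ∃ p ∈ Polynomial.degreeLT ℂ i, eLpNorm (fun y => f y - p.eval (y : ℂ)) 2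
      (volume.restrict (Icc c d)) ≤ B * ENNReal.ofReal ((d - c) ^ (s + 1 / 2)) := by
  have hL : 0 < d - c := sub_pos.2 hcd
  have h0 : ENNReal.ofReal (d - c) ≠ 0 := (ENNReal.ofReal_pos.2 hL).ne'
  have ht : ENNReal.ofReal (d - c) ≠ ⊤ := ENNReal.ofReal_ne_top
  have h1 : ENNReal.ofReal (d - c) ^ (-(s + 1 / 2)) * polyDist i c d (fun _ : Unit => f) < B := by
    rw [← iInf_campanato_eq i s _ hcd]
    refine lt_of_le_of_lt ?_ hB
    rw [campanatoMaxScalar, campanatoMax]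
    exact le_iSup_of_le c (le_iSup_of_le d (le_iSup_of_le hcd (le_iSup_of_le hx le_rfl)))
  rw [ENNReal.rpow_neg, ← ENNReal.div_eq_inv_mul, ENNReal.div_lt_iff
    (Or.inl (ENNReal.rpow_pos h0.bot_lt ht).ne') (Or.inl (ENNReal.rpow_ne_top_of_ne_zero h0 ht)),
    polyDist, iInf_lt_iff] at h1
  obtain ⟨P, hP⟩ := h1
  refine ⟨P (), (P ()).2, ?_⟩
  rw [eLpNorm_two_eq, ← ENNReal.ofReal_rpow_of_pos hL]
  refine le_trans (le_of_eq ?_) hP.le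
  rw [l2norm]
  simp only [tsum_fintype, Finset.univ_unique, Finset.sum_singleton]

theorem IsProfile.exists_campanatoMax_segOp_le {θ : ℝ → ℂ} {K : ℝ} (hθ : IsProfile θ K)
    (i r : ℕ) (s : ℝ) (hr : 1 ≤ r) (hrs : max s ((i : ℝ) - 1) < (r : ℝ)) :
    ∃ C : ℝ≥0, ∀ (ι : Type) [Countable ι] (e l : ι → ℝ), IsSegmentFamily e l →
      ∀ (f : Lp ℂ 2 (volume : Measure ℝ)) (x : ℝ),
        campanatoMax r 2 s (segOp θ e l f) x ≤ C * campanatoMaxScalar i 2 s f x := by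
  obtain ⟨C, hC0, hC⟩ := hθ.exists_polyDist_segOp_le_of_rate i r s hr hrs
  -- C may be 0; C + 1 can be divided by when B is let down to the maximal function.
  refine ⟨(C + 1).toNNReal, fun ι _ e l hf f x => ?_⟩
  rw [campanatoMax]
  refine iSup_le fun c => iSup_le fun d => iSup_le fun hcd => iSup_le fun hx => ?_
  have hL : 0 < d - c := sub_pos.2 hcd
  have h0 : ENNReal.ofReal (d - c) ≠ 0 := (ENNReal.ofReal_pos.2 hL).ne'
  have ht : ENNReal.ofReal (d - c) ≠ ⊤ := ENNReal.ofReal_ne_top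
  rw [iInf_campanato_eq r s _ hcd]
  set A := campanatoMaxScalar i 2 s f x with hA
  have hkey : ∀ B, A < B → ENNReal.ofReal (d - c) ^ (-(s + 1 / 2)) *
      polyDist r c d (segOp θ e l f) ≤ ENNReal.ofReal (C + 1) * B := by
    intro B hB
    set x₀ := (c + d) / 2 with hx₀
    set L := d - c with hLdef
    have hQ : ∀ k : ℕ, ∃ p ∈ Polynomial.degreeLT ℂ i,
        eLpNorm (fun y => f y - p.eval (y : ℂ)) 2 (volume.restrict (dyadicDilate x₀ L k)) ≤
          B * ENNReal.ofReal ((2 ^ k * L) ^ (s + 1 / 2)) := by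
      intro k
      have hpos : 0 < 2 ^ k * (L / 2) := by positivity
      have hmem : x ∈ dyadicDilate x₀ L k := by
        refine dyadicDilate_mono hL (Nat.zero_le k) ?_
        rw [mem_dyadicDilate, pow_zero, one_mul, abs_le]
        constructor <;> linarith [hx.1, hx.2]
      obtain ⟨p, hp, h⟩ := exists_polynomial_of_campanatoMaxScalar_lt hB
        (by linarith : x₀ - 2 ^ k * (L / 2) < x₀ + 2 ^ k * (L / 2)) hmem
      refine ⟨p, hp, ?_⟩
      rwa [show x₀ + 2 ^ k * (L / 2) - (x₀ - 2 ^ k * (L / 2)) = 2 ^ k * L by ring] at h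
    choose p hp hpB using hQ
    have h1 := hC ι e l hf f x₀ L hL B p hp hpB
    rw [show x₀ - L / 2 = c by rw [hx₀, hLdef]; ring, show x₀ + L / 2 = d by
      rw [hx₀, hLdef]; ring] at h1
    rw [ENNReal.rpow_neg, ← ENNReal.div_eq_inv_mul]
    refine ENNReal.div_le_of_le_mul (h1.trans ?_)
    rw [ENNReal.ofReal_mul hC0, ← ENNReal.ofReal_rpow_of_pos hL, ← mul_assoc, mul_comm B]
    gcongr
    linarith
  have hC1 : ENNReal.ofReal (C + 1) ≠ 0 := (ENNReal.ofReal_pos.2 (by linarith)).ne'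
  change _ ≤ ENNReal.ofReal (C + 1) * A
  by_contra! hlt
  rw [mul_comm, ← ENNReal.lt_div_iff_mul_lt (Or.inl hC1) (Or.inl ENNReal.ofReal_ne_top)] at hlt
  obtain ⟨B, hB1, hB2⟩ := exists_between hlt
  rw [ENNReal.lt_div_iff_mul_lt (Or.inl hC1) (Or.inl ENNReal.ofReal_ne_top), mul_comm] at hB2
  exact absurd (hkey B hB1) (not_le.2 hB2)

theorem exists_norm_le_of_support {ψ : ℝ → ℂ} (hψ : ContDiffOn ℝ ∞ ψ (Icc 0 1))
    (hsupp : Function.support ψ ⊆ Icc 0 1) : ∃ K : ℝ, ∀ t, ‖ψ t‖ ≤ K := by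
  obtain ⟨K, hK⟩ := isCompact_Icc.exists_bound_of_continuousOn hψ.continuousOn
  refine ⟨max K 0, fun t => ?_⟩
  by_cases ht : t ∈ Icc (0 : ℝ) 1
  · exact (hK t ht).trans (le_max_left _ _)
  · have : ψ t = 0 := by
      by_contra h
      exact ht (hsupp h)
    rw [this, norm_zero]
    exact le_max_right _ _

/-- If a ≥ 0, then a + l t ≥ l t. Otherwise b ≤ 0, and for t ≤ 2/3 the point a + l t lies at least
l/3 below b, while l t ≤ 2l/3; this is the origin of the factor 2 in `IsSegmentFamily.away`. -/
theorem isSegmentFamily_left {ι : Type*} {a b : ι → ℝ} (hab : ∀ m, a m < b m)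
    (hd : ∀ m n, m ≠ n → Disjoint (Icc (a m) (b m)) (Icc (a n) (b n)))
    (h0 : ∀ m, (0 : ℝ) ∉ Ioo (a m) (b m)) : IsSegmentFamily a fun m => b m - a m := by
  have hseg : ∀ m, segmentSet (a m) (b m - a m) ⊆ Icc (a m) (b m) := by
    intro m ξ hξ
    have hl := sub_pos.2 (hab m)
    have h1 := (le_div_iff₀ hl).1 hξ.1
    have h2 := (div_le_one hl).1 hξ.2
    constructor <;> linarith
  refine ⟨fun m => (sub_pos.2 (hab m)).ne', fun m n hmn => (hd m n hmn).mono (hseg m) (hseg n), ?_⟩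
  intro m t ht
  have hl := sub_pos.2 (hab m)
  have hlt : 0 ≤ (b m - a m) * t := mul_nonneg hl.le ht.1
  have hlt' : (b m - a m) * t ≤ (b m - a m) * (2 / 3) := by gcongr; exact ht.2
  rw [abs_of_nonneg hlt]
  rcases lt_or_ge (a m) 0 with ha | ha
  · have hb : b m ≤ 0 := by
      by_contra hb
      exact h0 m ⟨ha, not_le.1 hb⟩
    linarith [neg_le_abs (a m + (b m - a m) * t)]
  · linarith [le_abs_self (a m + (b m - a m) * t)]

theorem isSegmentFamily_right {ι : Type*} {a b : ι → ℝ} (hab : ∀ m, a m < b m)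
    (hd : ∀ m n, m ≠ n → Disjoint (Icc (a m) (b m)) (Icc (a n) (b n)))
    (h0 : ∀ m, (0 : ℝ) ∉ Ioo (a m) (b m)) : IsSegmentFamily b fun m => a m - b m := by
  have hseg : ∀ m, segmentSet (b m) (a m - b m) ⊆ Icc (a m) (b m) := by
    intro m ξ hξ
    have hl := sub_neg.2 (hab m)
    have h1 := (le_div_iff_of_neg hl).1 hξ.1
    have h2 := (div_le_iff_of_neg hl).1 hξ.2
    constructor <;> linarith
  refine ⟨fun m => (sub_neg.2 (hab m)).ne, fun m n hmn => (hd m n hmn).mono (hseg m) (hseg n), ?_⟩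
  intro m t ht
  have hl := sub_pos.2 (hab m)
  have hlt : 0 ≤ (b m - a m) * t := mul_nonneg hl.le ht.1
  have hlt' : (b m - a m) * t ≤ (b m - a m) * (2 / 3) := by gcongr; exact ht.2
  have he : (a m - b m) * t = -((b m - a m) * t) := by ring
  rw [he, abs_neg, abs_of_nonneg hlt]
  rcases lt_or_ge (a m) 0 with ha | ha
  · have hb : b m ≤ 0 := by
      by_contra hb
      exact h0 m ⟨ha, not_le.1 hb⟩
    linarith [neg_le_abs (b m + -((b m - a m) * t))]
  · linarith [le_abs_self (b m + -((b m - a m) * t))]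

theorem opS₁_eq_segOp {ι : Type*} (ψ : ℝ → ℂ) (a b : ι → ℝ) (f : Lp ℂ 2 (volume : Measure ℝ)) :
    opS₁ ψ a b f = segOp ψ a (fun m => b m - a m) f := rfl

/-- Running the segment from b to a changes the parameter t into 1 - t, so the right ends become
base points. -/
theorem opS₂_eq_segOp {ι : Type*} (ψ : ℝ → ℂ) {a b : ι → ℝ} (hab : ∀ m, a m < b m)
    (f : Lp ℂ 2 (volume : Measure ℝ)) :
    opS₂ ψ a b f = segOp (fun t => ψ (1 - t)) b (fun m => a m - b m) f := by
  funext m x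
  have h : transplant ψ (a m) (b m) = segSymbol (fun t => ψ (1 - t)) (b m) (a m - b m) := by
    funext ξ
    rw [transplant, segSymbol]
    congr 1
    have h1 : b m - a m ≠ 0 := (sub_pos.2 (hab m)).ne'
    have h2 : a m - b m ≠ 0 := (sub_neg.2 (hab m)).ne
    field_simp
    ring
  rw [opS₂, segOp, h]

end

theorem theorem1
    (ψ₁ ψ₂ : ℝ → ℂ)
    (hψ₁ : ContDiffOn ℝ ∞ ψ₁ (Icc 0 1)) (hψ₂ : ContDiffOn ℝ ∞ ψ₂ (Icc 0 1))
    (hsupp₁ : Function.support ψ₁ ⊆ Icc 0 (2 / 3))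
    (hsupp₂ : Function.support ψ₂ ⊆ Icc (1 / 3) 1)
    (hsum : ∀ ξ ∈ Icc (0 : ℝ) 1, ψ₁ ξ + ψ₂ ξ = 1)
    (i r : ℕ) (s : ℝ) (hr : 1 ≤ r) (hs : s ∈ Ioc (-1 / 2 : ℝ) (i : ℝ))
    (hrs : max s ((i : ℝ) - 1) < (r : ℝ)) :
    ∃ C : ℝ≥0, ∀ (ι : Type) [Countable ι] (a b : ι → ℝ),
      (∀ m, a m < b m) →
      (∀ m n, m ≠ n → Disjoint (Icc (a m) (b m)) (Icc (a n) (b n))) →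
      (∀ m, (0 : ℝ) ∉ Ioo (a m) (b m)) →
      ∀ (f : Lp ℂ 2 (volume : Measure ℝ)) (x : ℝ),
        campanatoMax r 2 s (opS₁ ψ₁ a b f) x ≤ C * campanatoMaxScalar i 2 s f x ∧
        campanatoMax r 2 s (opS₂ ψ₂ a b f) x ≤ C * campanatoMaxScalar i 2 s f x := by
  obtain ⟨K₁, hK₁⟩ := exists_norm_le_of_support hψ₁
    (hsupp₁.trans (Icc_subset_Icc_right (by norm_num)))
  obtain ⟨K₂, hK₂⟩ := exists_norm_le_of_support hψ₂
    (hsupp₂.trans (Icc_subset_Icc_left (by norm_num)))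
  have hθ₁ : IsProfile ψ₁ K₁ := ⟨hψ₁, hsupp₁, hK₁⟩
  -- Reflection moves the support from [1/3, 1] to [0, 2/3].
  have hθ₂ : IsProfile (fun t => ψ₂ (1 - t)) K₂ := by
    refine ⟨hψ₂.comp (by fun_prop : ContDiff ℝ ∞ fun t : ℝ => 1 - t).contDiffOn fun t ht => ?_,
      fun t ht => ?_, fun t => hK₂ _⟩
    · constructor <;> linarith [ht.1, ht.2]
    · have h := hsupp₂ (show 1 - t ∈ Function.support ψ₂ from ht)
      constructor <;> linarith [h.1, h.2]
  obtain ⟨C₁, hC₁⟩ := hθ₁.exists_campanatoMax_segOp_le i r s hr hrs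
  obtain ⟨C₂, hC₂⟩ := hθ₂.exists_campanatoMax_segOp_le i r s hr hrs
  refine ⟨C₁ + C₂, fun ι _ a b hab hd h0 f x => ⟨?_, ?_⟩⟩
  · rw [opS₁_eq_segOp]
    refine (hC₁ ι a _ (isSegmentFamily_left hab hd h0) f x).trans ?_
    gcongr
    exact le_self_add
  · rw [opS₂_eq_segOp ψ₂ hab]
    refine (hC₂ ι b _ (isSegmentFamily_right hab hd h0) f x).trans ?_
    gcongr
    exact le_add_self
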